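/- **Setting.** Let $H=H_+\oplus H_-$ be a polarized separable complex Hilbert space with orthonormal basis $(e_k)_{k\in\mathbb Z\setminus\{0\}}$, where the $e_k$ with $k>0$ span $H_+$ and those with $k<0$ span $H_-$. All indices below run over $\mathbb Z\setminus\{0\}$. Let $\mathcal F$ be the fermionic Fock space of $(H,H_+)$, with vacuum $|0\rangle_{\mathcal F}$ and field operators $\psi_k,\psi_k^*$, so that $\psi_i\psi_j^*+\psi_j^*\psi_i=\delta_{ij}$, all other anticommutators vanish, $\psi_k|0\rangle_{\mathcal F}=0$ for $k>0$ and $\psi_k^*|0\rangle_{\mathcal F}=0$ for $k<0$. The basic representation $\hat r$ of the centrally extended $\mathfrak{gl}_{\mathrm{res}}$ is given on matrix units by $E_{pq}=\hat r(E_{pq})=\psi_p^*\psi_q$, except that $E_{pq}=-\psi_q\psi_p^*$ if $p,q<0$. Let $\mathbb S$ be the spinor module: the fermionic Fock space with vacuum $|0\rangle_{\mathbb S}$ on which the Clifford generators $\gamma_{ij}=\gamma(E_{ij})$ ($ij<0$) act with $\gamma_{ij}\gamma_{mn}+\gamma_{mn}\gamma_{ij}=2\delta_{in}\delta_{jm}$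 and $\gamma_{ij}|0\rangle_{\mathbb S}=0$ for $i<0<j$. Let $\mathcal F^{\mathrm{pol}}\subset\mathcal F$ and $\mathbb S^{\mathrm{pol}}\subset\mathbb S$ be the finite linear combinations of the monomial basis vectors. For $pq>0$ let $\mathrm{ad}(E_{pq})$ be the isotropy representation on $\mathbb S^{\mathrm{pol}}$, i.e. the derivation $\gamma_{m_1l_1}\cdots\gamma_{m_kl_k}|0\rangle_{\mathbb S}\mapsto\sum_h\gamma_{m_1l_1}\cdots\gamma([E_{pq},E_{m_hl_h}])\cdots\gamma_{m_kl_k}|0\rangle_{\mathbb S}$, and let the $\mathfrak h$-invariant sector $(\mathcal F^{\mathrm{pol}}\otimes\mathbb S^{\mathrm{pol}})^{\mathfrak h}$ consist of all $w$ with $(E_{pq}\otimes1+1\otimes\mathrm{ad}(E_{pq}))w=0$ for all $p,q$ with $pq>0$. For $ij>0$ put $$K^{(N)}_{ij}=\tfrac12\sum_{ik<0,\,|k|\le N}\gamma_{ik}\gamma_{kj},\qquad \widetilde K_{ij}=\tfrac12\sum_{ik<0}{:}\gamma_{ik}\gamma_{kj}{:},\qquad \widetilde K^{(N)}_{ij}=\tfrac12\sum_{ik<0,\,|k|\le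 N}{:}\gamma_{ik}\gamma_{kj}{:},$$ where ${:}\gamma_{ik}\gamma_{kj}{:}=-\gamma_{ki}\gamma_{ik}$ if $i=j<k$, and $=\gamma_{ik}\gamma_{kj}$ otherwise. Define $$\partial\!\!\!/=\tfrac12\sum_{ij<0}E_{ij}\otimes\gamma_{ji},\qquad F=\sum_i\mathrm{sign}(i)\widetilde K_{ii},$$ $$\Delta_{\mathfrak g}=2\sum_{j<i}E_{ij}E_{ji}+\sum_iE_{ii}\bigl(E_{ii}-2i+\mathrm{sign}(i)\bigr),$$ and the cut-offs $$\partial\!\!\!/_{(N)}=\tfrac12\sum_{ij<0,\,|i|,|j|\le N}E_{ij}\otimes\gamma_{ji},\quad \Delta^{(N)}_{\mathfrak g}=\sum_{|i|,|j|\le N}E_{ij}E_{ji},\quad \Delta^{(N)}_{\mathfrak g,\mathrm{ren}}=\Delta^{(N)}_{\mathfrak g}-N^2,$$ $$F_{(N)}=\sum_{|i|\le N}\mathrm{sign}(i)\widetilde K^{(N)}_{ii},\quad C_{(N)}=\sum_{ij>0,\,|i|,|j|\le N}K^{(N)}_{ij}K^{(N)}_{ji},\quad T_{(N)}=N\sum_{|i|\le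 N}\widetilde K^{(N)}_{ii},$$ $$\varrho_N(E_{ij})=E_{ij}\otimes1+1\otimes\widetilde K^{(N)}_{ij},\quad \Delta^{(N)}_\varrho=\sum_{ij>0,\,|i|,|j|\le N}\varrho_N(E_{ij})\varrho_N(E_{ji}),\quad R_{(N)}=N\sum_{|i|\le N}\mathrm{sign}(i)\varrho_N(E_{ii}).$$ **Theorem.** 1. The infinite sums defining $\widetilde K_{ij}$, $F$ (on $\mathbb S^{\mathrm{pol}}$), $\Delta_{\mathfrak g}$ (on $\mathcal F^{\mathrm{pol}}$; each of its two sums) and $\partial\!\!\!/$ (on $\mathcal F^{\mathrm{pol}}\otimes\mathbb S^{\mathrm{pol}}$) have only finitely many nonzero terms on each fixed vector, and $\widetilde K_{ij}=\mathrm{ad}(E_{ij})$ for $ij>0$. 2. The invariant sector contains $|0\rangle_{\mathcal F}\otimes|0\rangle_{\mathbb S}$ and is mapped into itself by $\partial\!\!\!/$. As unbounded operators in the Hilbert space $\mathcal F\otimes\mathbb S$ with domain $(\mathcal F^{\mathrm{pol}}\otimes\mathbb S^{\mathrm{pol}})^{\mathfrak h}$, $$4\,\partial\!\!\!/^{\,2}=\Delta_{\mathfrak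 g}\otimes1+1\otimes F .$$ 3. For each $\varphi\in\mathcal F^{\mathrm{pol}}\otimes\mathbb S^{\mathrm{pol}}$ there is $N_\varphi$ such that for all $N\ge N_\varphi$: $\partial\!\!\!/_{(N)}\varphi=\partial\!\!\!/\varphi$, $\partial\!\!\!/^{\,2}_{(N)}\varphi=\partial\!\!\!/^{\,2}\varphi$, $(\Delta^{(N)}_{\mathfrak g,\mathrm{ren}}\otimes1)\varphi=(\Delta_{\mathfrak g}\otimes1)\varphi$, $(1\otimes F_{(N)})\varphi=(1\otimes F)\varphi$, $(1\otimes C_{(N)})\varphi=N^3\varphi$, $(1\otimes T_{(N)})\varphi=0$, and $$4\,\partial\!\!\!/^{\,2}_{(N)}\varphi=\Bigl((\Delta^{(N)}_{\mathfrak g}-N^2)\otimes1+1\otimes(C_{(N)}-N^3)+1\otimes F_{(N)}-1\otimes T_{(N)}-(\Delta^{(N)}_\varrho-R_{(N)})\Bigr)\varphi .$$ 4. For each $\varphi$ in the invariant sector there is $N_\varphi$ such that for all $N\ge N_\varphi$: $\varrho_N(E_{pq})\varphi=0$ for all $p,q$ with $pq>0$ and $|p|,|q|\le N$; $\Delta^{(N)}_\varrho\varphi=0$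 and $R_{(N)}\varphi=0$; and $$4\,\partial\!\!\!/^{\,2}\varphi=4\,\partial\!\!\!/^{\,2}_{(N)}\varphi=\bigl(\Delta^{(N)}_{\mathfrak g,\mathrm{ren}}\otimes1+1\otimes F_{(N)}\bigr)\varphi ,$$ so that all terms polynomial in $N$ have cancelled. -/

import Mathlib

open scoped TensorProduct

noncomputable section

namespace GrRes

/-! ### Fermionic Fock spaces in the occupation-number basis -/

/-- The space of polynomial elements of the fermionic Fock space over a one-particle Hilbert space
with orthonormal basis `(e_k)_{k : ι}`: finite linear combinations of the basis vectors
`|S⟩ = e_{s₁} ∧ ⋯ ∧ e_{sₙ}`, where `S = {s₁ > ⋯ > sₙ}` runs through the finite subsets of `ι`. -/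
abbrev FockPol (ι : Type) : Type := Finset ι →₀ ℂ

/-- The vacuum vector `|∅⟩`. -/
def vac (ι : Type) : FockPol ι := Finsupp.single ∅ 1

/-- The creator `a*(e_k)`: `x ↦ e_k ∧ x`. -/
def create {ι : Type} [LinearOrder ι] (k : ι) : Module.End ℂ (FockPol ι) :=
  Finsupp.linearCombination ℂ fun S : Finset ι =>
    if k ∈ S then 0 else Finsupp.single (insert k S) ((-1 : ℂ) ^ (S.filter (k < ·)).card)

/-- The annihilator `a(e_k)`:
`e_{s₁} ∧ ⋯ ∧ e_{sₙ} ↦ ∑ⱼ (-1)^(j+1) ⟨e_k, e_{sⱼ}⟩ e_{s₁} ∧ ⋯ ê_{sⱼ} ⋯ ∧ e_{sₙ}`. -/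
def annihilate {ι : Type} [LinearOrder ι] (k : ι) : Module.End ℂ (FockPol ι) :=
  Finsupp.linearCombination ℂ fun S : Finset ι =>
    if k ∈ S then Finsupp.single (S.erase k) ((-1 : ℂ) ^ (S.filter (k < ·)).card) else 0

/-! ### Pointwise finite sums of operators -/

/-- The family of operators `T` is pointwise finite: on each fixed vector only finitely many
members are nonzero. -/
def PointwiseFinite {α V : Type} [AddCommMonoid V] [Module ℂ V] (T : α → Module.End ℂ V) : Prop :=
  ∀ v : V, {a : α | T a v ≠ 0}.Finite

open Classical in
/-- The sum `v ↦ ∑ₐ T a v` of a pointwise finite family of operators (and `0` for a family which is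
not pointwise finite). -/
def opSum {α V : Type} [AddCommMonoid V] [Module ℂ V] (T : α → Module.End ℂ V) : Module.End ℂ V :=
  if h : PointwiseFinite T then
    { toFun := fun v => ∑ᶠ a, T a v
      map_add' := fun v w => by
        simp only [map_add]
        exact finsum_add_distrib (h v) (h w)
      map_smul' := fun c v => by
        simp only [map_smul, RingHom.id_apply]
        exact (smul_finsum' c (h v)).symm }
  else 0

/-! ### The basic representation on `𝓕(H, H₊)` -/

/-- The index set `ℤ ∖ {0}` of the orthonormal basis `(e_k)` of `H`: the `e_k` with `k > 0` span
`H₊`, those with `k < 0` span `H₋`. -/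
abbrev Idx : Type := {k : ℤ // k ≠ 0}

/-- The indices `k` with `|k| ≤ N`. -/
def cut (N : ℕ) : Finset Idx := (Finset.Icc (-(N : ℤ)) (N : ℤ)).subtype (fun k => k ≠ 0)

/-- The sign of an index, as a complex number. -/
def sgn (i : Idx) : ℂ := ((i.1.sign : ℤ) : ℂ)

/-- The polynomial elements of the fermionic Fock space `𝓕(H, H₊)`. The mode `k > 0` is the
particle `e_k`, the mode `k < 0` is the anti-particle `C e_k`; the positive modes come first in the
basis vectors, so that these are `e_{i₁} ∧ ⋯ ∧ e_{iₙ} ⊗ C e_{j₁} ∧ ⋯ ∧ C e_{jₘ}`, and the sign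
`(-1)ⁿ` in `b*` and `b` is the one in `create` and `annihilate`. -/
abbrev FPol : Type := FockPol Idx

/-- The field operator `ψ_k = Ψ(e_k)`: the annihilator of the particle `e_k` for `k > 0`, the
creator of the anti-particle `C e_k` for `k < 0`. -/
def psi (k : Idx) : Module.End ℂ FPol := if 0 < k.1 then annihilate k else create k

/-- The field operator `ψ_k^* = Ψ*(e_k)`. -/
def psiStar (k : Idx) : Module.End ℂ FPol := if 0 < k.1 then create k else annihilate k

/-- The basic representation of the central extension of `𝔤𝔩_res` on the matrix unit `E_{pq}`: the
normal ordered operator `ψ_p^* ψ_q`. -/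
def rhat (p q : Idx) : Module.End ℂ FPol :=
  if p.1 < 0 ∧ q.1 < 0 then -(psi q * psiStar p) else psiStar p * psi q

/-- The naive cut-off Casimir operator `∑_{|i|,|j| ≤ N} E_{ij} E_{ji}`. -/
def casimirCut (N : ℕ) : Module.End ℂ FPol :=
  ∑ i ∈ cut N, ∑ j ∈ cut N, rhat i j * rhat j i

/-- The normal ordered cut-off Casimir operator `∑_{|i|,|j| ≤ N} E_{ij} E_{ji} - N²`. -/
def casimirRenCut (N : ℕ) : Module.End ℂ FPol := casimirCut N - ((N : ℂ) ^ 2) • 1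

/-- The off-diagonal terms `E_{ij} E_{ji}`, `j < i`, of the normal ordered Casimir operator. -/
def casimirOffDiag (x : Idx × Idx) : Module.End ℂ FPol :=
  if x.2.1 < x.1.1 then rhat x.1 x.2 * rhat x.2 x.1 else 0

/-- The diagonal terms `E_{ii} (E_{ii} - 2i + sign i)` of the normal ordered Casimir operator. -/
def casimirDiag (i : Idx) : Module.End ℂ FPol :=
  rhat i i * (rhat i i - (2 * (i.1 : ℂ)) • 1 + sgn i • 1)

/-- The normal ordered Casimir operator
`Δ_g = 2 ∑_{j < i} E_{ij} E_{ji} + ∑_i E_{ii} (E_{ii} - 2i + sign i)`. -/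
def casimir : Module.End ℂ FPol := (2 : ℂ) • opSum casimirOffDiag + opSum casimirDiag

/-! ### The spinor module of the Clifford algebra of `𝔭^ℂ` -/

/-- The modes of the spinor module: the pair `(m, l)` with `m > 0 > l` is the mode created by
`γ(E_{ml})`. -/
abbrev SMode : Type := {m : ℤ // 0 < m} ×ₗ {l : ℤ // l < 0}

/-- The polynomial elements of the spinor module. -/
abbrev SPol : Type := FockPol SMode

/-- The Clifford generators `γ_{ij} = γ(E_{ij})`, `ij < 0` (set to `0` for `ij > 0`). As
`E_{ij} = √2 X_{ij}` with `X_{ij}` orthonormal, `γ_{ij}` is `√2` times a creator for `i > 0 > j`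
and `√2` times an annihilator for `i < 0 < j`, and `γ_{ij} γ_{mn} + γ_{mn} γ_{ij} = 2 δ_{in} δ_{jm}`. -/
def gam (i j : Idx) : Module.End ℂ SPol :=
  if h : 0 < i.1 ∧ j.1 < 0 then
    ((Real.sqrt 2 : ℝ) : ℂ) • create (toLex (⟨i.1, h.1⟩, ⟨j.1, h.2⟩) : SMode)
  else if h : i.1 < 0 ∧ 0 < j.1 then
    ((Real.sqrt 2 : ℝ) : ℂ) • annihilate (toLex (⟨j.1, h.2⟩, ⟨i.1, h.1⟩) : SMode)
  else 0

/-- The normal ordered product of `γ_{ik}` and `γ_{kj}`, for `ij > 0` and `ik < 0`. -/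
def gamNormal (i k j : Idx) : Module.End ℂ SPol :=
  if i = j ∧ i.1 < k.1 then -(gam k i * gam i k) else gam i k * gam k j

/-- `K_{ij}^{(N)} = ½ ∑_{|k| ≤ N, ik < 0} γ_{ik} γ_{kj}`. -/
def KCut (N : ℕ) (i j : Idx) : Module.End ℂ SPol :=
  (1 / 2 : ℂ) • ∑ k ∈ (cut N).filter (fun k => i.1 * k.1 < 0), gam i k * gam k j

/-- `K̃_{ij}^{(N)}`, the normal ordered version of `K_{ij}^{(N)}`. -/
def KtCut (N : ℕ) (i j : Idx) : Module.End ℂ SPol :=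
  (1 / 2 : ℂ) • ∑ k ∈ (cut N).filter (fun k => i.1 * k.1 < 0), gamNormal i k j

/-- The terms of `K̃_{ij}`. -/
def KtTerm (i j k : Idx) : Module.End ℂ SPol :=
  if i.1 * k.1 < 0 then (1 / 2 : ℂ) • gamNormal i k j else 0

/-- `K̃_{ij}`, the normal ordered infinite sum `½ ∑_{ik < 0} γ_{ik} γ_{kj}`. -/
def Kt (i j : Idx) : Module.End ℂ SPol := opSum (KtTerm i j)

/-- The terms `sign(i) K̃_{ii}` of the operator `F`. -/
def numTerm (i : Idx) : Module.End ℂ SPol := sgn i • Kt i i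

/-- `F = ∑_i sign(i) K̃_{ii}`. -/
def num : Module.End ℂ SPol := opSum numTerm

/-- `F_{(N)} = ∑_{|i| ≤ N} sign(i) K̃_{ii}^{(N)}`. -/
def numCut (N : ℕ) : Module.End ℂ SPol := ∑ i ∈ cut N, sgn i • KtCut N i i

/-- The cut-off spinor Casimir operator `∑_{ij > 0, |i|,|j| ≤ N} K_{ij}^{(N)} K_{ji}^{(N)}`. -/
def spinCasimirCut (N : ℕ) : Module.End ℂ SPol :=
  ∑ i ∈ cut N, ∑ j ∈ (cut N).filter (fun j => 0 < i.1 * j.1), KCut N i j * KCut N j i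

/-- `T(N) = N ∑_{|i| ≤ N} K̃_{ii}^{(N)}`. -/
def traceCut (N : ℕ) : Module.End ℂ SPol := (N : ℂ) • ∑ i ∈ cut N, KtCut N i i

/-- The index `m` of a mode `(m, l)`. -/
def SMode.fst (x : SMode) : Idx := ⟨(ofLex x).1.1, (ofLex x).1.2.ne'⟩

/-- The index `l` of a mode `(m, l)`. -/
def SMode.snd (x : SMode) : Idx := ⟨(ofLex x).2.1, (ofLex x).2.2.ne⟩

/-- `γ([E_{pq}, E_{ml}]) = δ_{qm} γ_{pl} - δ_{lp} γ_{mq}`. -/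
def gamBracket (p q m l : Idx) : Module.End ℂ SPol :=
  (if q = m then gam p l else 0) - (if l = p then gam m q else 0)

/-- The isotropy representation `ad(E_{pq})`, `pq > 0`, on the spinor module: the derivation
`γ_{m₁l₁} ⋯ γ_{mₖlₖ} |0⟩ ↦ ∑ₕ γ_{m₁l₁} ⋯ γ([E_{pq}, E_{mₕlₕ}]) ⋯ γ_{mₖlₖ} |0⟩`.
(To replace the factor `γ_{ml}` in such a product, remove it by `½ γ_{lm}` and multiply by the new
factor from the left: the two signs are the same.) -/
def isotropy (p q : Idx) : Module.End ℂ SPol :=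
  Finsupp.linearCombination ℂ fun S : Finset SMode =>
    ∑ x ∈ S, (1 / 2 : ℂ) •
      (gamBracket p q x.fst x.snd * gam x.snd x.fst) (Finsupp.single S 1)

/-! ### The tensor product, the invariant sectors and the Dirac operator -/

/-- `𝓕^pol ⊗ 𝕊^pol` (algebraic tensor product). -/
abbrev Pol : Type := FPol ⊗[ℂ] SPol

/-- The operator `A ⊗ B`. -/
def tmap (A : Module.End ℂ FPol) (B : Module.End ℂ SPol) : Module.End ℂ Pol :=
  TensorProduct.map A B

/-- The vacuum `|0⟩_𝓕 ⊗ |0⟩_𝕊`. -/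
def vacuum : Pol := vac Idx ⊗ₜ[ℂ] vac SMode

/-- The diagonal representation `ϱ(E_{pq}) = r̂(E_{pq}) ⊗ 1 + 1 ⊗ ad(E_{pq})`, `pq > 0`. -/
def rho (p q : Idx) : Module.End ℂ Pol := tmap (rhat p q) 1 + tmap 1 (isotropy p q)

/-- The `𝔥`-invariant sector `(𝓕^pol ⊗ 𝕊^pol)^𝔥`: the vectors annihilated by all `ϱ(E_{pq})`,
`pq > 0`. -/
def sector : Submodule ℂ Pol :=
  ⨅ (p : Idx) (q : Idx) (_ : 0 < p.1 * q.1), LinearMap.ker (rho p q)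

/-- The cut-off diagonal representation `ϱ_N(E_{pq}) = r̂(E_{pq}) ⊗ 1 + 1 ⊗ K̃_{pq}^{(N)}`. -/
def rhoCut (N : ℕ) (p q : Idx) : Module.End ℂ Pol := tmap (rhat p q) 1 + tmap 1 (KtCut N p q)

/-- The `N`-th level invariant sector: the vectors annihilated by all `ϱ_N(E_{pq})`, `pq > 0`,
`|p|, |q| ≤ N`. -/
def sectorCut (N : ℕ) : Submodule ℂ Pol :=
  ⨅ (p : Idx) (q : Idx) (_ : p ∈ cut N) (_ : q ∈ cut N) (_ : 0 < p.1 * q.1),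
    LinearMap.ker (rhoCut N p q)

/-- The cut-off diagonal Casimir operator `∑_{ij > 0, |i|,|j| ≤ N} ϱ_N(E_{ij}) ϱ_N(E_{ji})`. -/
def diagCasimirCut (N : ℕ) : Module.End ℂ Pol :=
  ∑ i ∈ cut N, ∑ j ∈ (cut N).filter (fun j => 0 < i.1 * j.1), rhoCut N i j * rhoCut N j i

/-- `N ∑_{|i| ≤ N} sign(i) ϱ_N(E_{ii})`. -/
def diagTraceCut (N : ℕ) : Module.End ℂ Pol := (N : ℂ) • ∑ i ∈ cut N, sgn i • rhoCut N i i

/-- The terms `½ E_{ij} ⊗ γ_{ji}`, `ij < 0`, of the Dirac operator. -/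
def diracTerm (x : Idx × Idx) : Module.End ℂ Pol :=
  if x.1.1 * x.2.1 < 0 then (1 / 2 : ℂ) • tmap (rhat x.1 x.2) (gam x.2 x.1) else 0

/-- The Dirac operator `½ ∑_{ij < 0} E_{ij} ⊗ γ_{ji}` on `𝓕^pol ⊗ 𝕊^pol`. -/
def dirac : Module.End ℂ Pol := opSum diracTerm

/-- The cut-off Dirac operator `½ ∑_{ij < 0, |i|,|j| ≤ N} E_{ij} ⊗ γ_{ji}`. -/
def diracCut (N : ℕ) : Module.End ℂ Pol := ∑ i ∈ cut N, ∑ j ∈ cut N, diracTerm (i, j)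

/-! ### Unbounded operators in the Hilbert space `𝓕 ⊗ 𝕊` -/

/-- The Hilbert space tensor product `𝓕 ⊗ 𝕊` of the two Fock spaces: the square-summable families
of coefficients with respect to the orthonormal basis `|S⟩ ⊗ |T⟩`. -/
abbrev Hil : Type := lp (fun _ : Finset Idx × Finset SMode => ℂ) 2

/-- The inclusion `𝓕^pol ⊗ 𝕊^pol → 𝓕 ⊗ 𝕊`. -/
def incl : Pol →ₗ[ℂ] Hil :=
  (Finsupp.linearCombination ℂ fun x : Finset Idx × Finset SMode =>
      (lp.single 2 x (1 : ℂ) : Hil)) ∘ₗ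
    (finsuppTensorFinsupp' ℂ (Finset Idx) (Finset SMode)).toLinearMap

theorem incl_injective : Function.Injective incl := by
  have key : Function.Injective (Finsupp.linearCombination ℂ
      fun x : Finset Idx × Finset SMode => (lp.single 2 x (1 : ℂ) : Hil)) := by
    intro f g hfg
    have coeff : ∀ (f : Finset Idx × Finset SMode →₀ ℂ) (y : Finset Idx × Finset SMode),
        (Finsupp.linearCombination ℂ
          (fun x : Finset Idx × Finset SMode => (lp.single 2 x (1 : ℂ) : Hil)) f : Hil) y = f y := by
      intro f y
      induction f using Finsupp.induction_linear with
      | zero => simp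
      | add f g hf hg => rw [map_add, lp.coeFn_add, Pi.add_apply, hf, hg, Finsupp.add_apply]
      | single a b =>
        rw [Finsupp.linearCombination_single, lp.coeFn_smul, Pi.smul_apply, lp.single_apply]
        by_cases h : y = a
        · subst h; simp
        · simp [h]
    ext y
    rw [← coeff f y, ← coeff g y, hfg]
  exact key.comp (finsuppTensorFinsupp' ℂ (Finset Idx) (Finset SMode)).injective

/-- The unbounded operator in `𝓕 ⊗ 𝕊` with domain `U ⊆ 𝓕^pol ⊗ 𝕊^pol` given there by `T`. -/
def unbounded (U : Submodule ℂ Pol) (T : Module.End ℂ Pol) : Hil →ₗ.[ℂ] Hil where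
  domain := U.map incl
  toFun := incl ∘ₗ T ∘ₗ U.subtype ∘ₗ
    (U.equivMapOfInjective incl incl_injective).symm.toLinearMap

end GrRes

end

/-! Everything reduces to an exact identity at finite cut-off, followed by the remark that on a
fixed vector all cut-offs stabilize.

With `D` twice the cut-off Dirac operator, moving one factor through the other in `D * D` uses only
three facts: the `E_{ij}` satisfy the `gl` relations up to a central term, the `γ_{ij}` satisfy
Clifford relations, and the two families commute. This yields the opposite-sign half of the Casimir
operator, mixed terms `E K`, and linear and constant terms (`CurrentClifford.D_mul_D`). The Casimir
operator of the diagonal representation contains the same-sign half and the mixed terms with the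
other sign. Adding the two gives `CurrentClifford.four_smul_dirac_sq`. The spinor Casimir is the
scalar `N³`, by cyclicity of a fourfold sum (`sum_K_mul_K`), and the normal ordered spinor trace
vanishes (`sum_Kt_diag`). Reordering `E_{ij} E_{ji}` for `i < j` turns the naive Casimir operator
into the normal ordered one plus `N²`, which comes from the central term
(`sum_casimir_of_commutator`).

Normal ordering puts annihilators to the right, so only finitely many terms act nontrivially on a
basis vector. For the currents `K̃_{ij}` the threshold can be chosen uniformly in `i, j`
(`eventually_KtCut_eq`), so an invariant vector lies in every cut-off sector with `N` large; there
the diagonal Casimir and trace terms vanish. -/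

open scoped TensorProduct

noncomputable section

namespace GrRes

open Filter

/-! ### Canonical anticommutation relations via Jordan–Wigner signs. -/

section CAR

variable {ι : Type} [LinearOrder ι]

/-- The Jordan–Wigner sign, as a product. -/
def jwSign (k : ι) (S : Finset ι) : ℂ := ∏ s ∈ S, if k < s then -1 else 1

theorem neg_one_pow_card_filter (k : ι) (S : Finset ι) :
    (-1 : ℂ) ^ (S.filter (k < ·)).card = jwSign k S := by
  simp [jwSign, Finset.prod_ite]

theorem jwSign_insert {k j : ι} {S : Finset ι} (h : j ∉ S) :
    jwSign k (insert j S) = (if k < j then -1 else 1) * jwSign k S :=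
  Finset.prod_insert h

theorem jwSign_erase {k j : ι} {S : Finset ι} (h : j ∈ S) :
    jwSign k (S.erase j) = (if k < j then -1 else 1) * jwSign k S := by
  rw [jwSign, jwSign, ← Finset.mul_prod_erase S _ h, ← mul_assoc]
  split_ifs <;> simp

theorem jwSign_mul_self (k : ι) (S : Finset ι) : jwSign k S * jwSign k S = 1 := by
  rw [jwSign, ← Finset.prod_mul_distrib]
  exact Finset.prod_eq_one fun s _ => by split_ifs <;> simp

theorem create_single (k : ι) (S : Finset ι) (c : ℂ) :
    create k (Finsupp.single S c) =
      if k ∈ S then 0 else Finsupp.single (insert k S) (c * jwSign k S) := by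
  rw [create, Finsupp.linearCombination_single, neg_one_pow_card_filter]
  split_ifs <;> simp

theorem annihilate_single (k : ι) (S : Finset ι) (c : ℂ) :
    annihilate k (Finsupp.single S c) =
      if k ∈ S then Finsupp.single (S.erase k) (c * jwSign k S) else 0 := by
  rw [annihilate, Finsupp.linearCombination_single, neg_one_pow_card_filter]
  split_ifs <;> simp

omit [LinearOrder ι] in
theorem fock_ext {V : Type} [AddCommMonoid V] [Module ℂ V] {A B : FockPol ι →ₗ[ℂ] V}
    (h : ∀ S, A (Finsupp.single S 1) = B (Finsupp.single S 1)) : A = B := by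
  refine Finsupp.lhom_ext' fun S => LinearMap.ext_ring (h S)

theorem create_mul_create (j k : ι) : create j * create k + create k * create j = 0 := by
  refine fock_ext fun S => ?_
  simp only [LinearMap.add_apply, Module.End.mul_apply, create_single, LinearMap.zero_apply]
  rcases eq_or_ne j k with rfl | hjk
  · by_cases hj : j ∈ S <;> simp [hj, create_single]
  by_cases hj : j ∈ S <;> by_cases hk : k ∈ S <;>
    simp only [hj, hk, if_true, if_false, map_zero, create_single, Finset.mem_insert, hjk, hjk.symm,
      or_true, or_false, add_zero, jwSign_insert, not_false_eq_true]
  rw [Finset.insert_comm, ← Finsupp.single_add, Finsupp.single_eq_zero]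
  rcases lt_or_gt_of_ne hjk with h | h <;> simp only [h, h.not_gt, if_true, if_false] <;> ring

theorem annihilate_mul_annihilate (j k : ι) :
    annihilate j * annihilate k + annihilate k * annihilate j = 0 := by
  refine fock_ext fun S => ?_
  simp only [LinearMap.add_apply, Module.End.mul_apply, annihilate_single, LinearMap.zero_apply]
  rcases eq_or_ne j k with rfl | hjk
  · by_cases hj : j ∈ S <;> simp [hj, annihilate_single]
  by_cases hj : j ∈ S <;> by_cases hk : k ∈ S <;>
    simp only [hj, hk, if_true, if_false, map_zero, annihilate_single, Finset.mem_erase, hjk,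
      hjk.symm, ne_eq, and_true, and_false, add_zero, jwSign_erase, not_false_eq_true]
  rw [Finset.erase_right_comm, ← Finsupp.single_add, Finsupp.single_eq_zero]
  rcases lt_or_gt_of_ne hjk with h | h <;> simp only [h, h.not_gt, if_true, if_false] <;> ring

theorem annihilate_mul_create (j k : ι) :
    annihilate j * create k + create k * annihilate j = if j = k then 1 else 0 := by
  refine fock_ext fun S => ?_
  simp only [LinearMap.add_apply, Module.End.mul_apply, annihilate_single, create_single]
  rcases eq_or_ne j k with rfl | hjk
  · by_cases hj : j ∈ S
    · simp [hj, create_single, jwSign_erase, jwSign_mul_self]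
    · simp [hj, annihilate_single, jwSign_insert, jwSign_mul_self]
  by_cases hj : j ∈ S <;> by_cases hk : k ∈ S <;>
    simp only [hj, hk, if_true, if_false, map_zero, annihilate_single, create_single,
      Finset.mem_erase, Finset.mem_insert, hjk, hjk.symm, ne_eq, and_true, or_false, or_true,
      and_false, add_zero, jwSign_erase, jwSign_insert, not_false_eq_true, LinearMap.zero_apply]
  rw [Finset.erase_insert_of_ne (Ne.symm hjk), ← Finsupp.single_add, Finsupp.single_eq_zero]
  rcases lt_or_gt_of_ne hjk with h | h <;> simp only [h, h.not_gt, if_true, if_false] <;> ring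

end CAR

/-! ### Field operators and the central extension. -/

theorem Idx.neg_iff (i : Idx) : i.1 < 0 ↔ ¬ 0 < i.1 := by
  have := i.2; omega

theorem Idx.pos_or_neg (i : Idx) : 0 < i.1 ∧ ¬ i.1 < 0 ∨ i.1 < 0 ∧ ¬ 0 < i.1 := by
  have := i.2; omega

theorem psi_mul_psi (i j : Idx) : psi i * psi j + psi j * psi i = 0 := by
  rcases i.pos_or_neg with hi | hi <;> rcases j.pos_or_neg with hj | hj <;>
    simp only [psi, hi, hj, if_true, if_false, create_mul_create, annihilate_mul_annihilate,
      annihilate_mul_create, add_comm (create _ * annihilate _)]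
  · exact if_neg fun h : i = j => hj.2 (h ▸ hi.1)
  · exact if_neg fun h : j = i => hi.2 (h ▸ hj.1)

theorem psiStar_mul_psiStar (i j : Idx) :
    psiStar i * psiStar j + psiStar j * psiStar i = 0 := by
  rcases i.pos_or_neg with hi | hi <;> rcases j.pos_or_neg with hj | hj <;>
    simp only [psiStar, hi, hj, if_true, if_false, create_mul_create, annihilate_mul_annihilate,
      annihilate_mul_create, add_comm (create _ * annihilate _)]
  · exact if_neg fun h : j = i => hi.2 (h ▸ hj.1)
  · exact if_neg fun h : i = j => hj.2 (h ▸ hi.1)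

theorem psi_mul_psiStar (i j : Idx) :
    psi i * psiStar j + psiStar j * psi i = if i = j then 1 else 0 := by
  rcases i.pos_or_neg with hi | hi <;> rcases j.pos_or_neg with hj | hj <;>
    simp only [psi, psiStar, hi, hj, if_true, if_false, create_mul_create,
      annihilate_mul_annihilate, annihilate_mul_create, add_comm (create _ * annihilate _)]
  all_goals rcases eq_or_ne i j with rfl | h
  all_goals first | (exfalso; omega) | simp [h, h.symm] | simp

/-- The indicator of the negative indices. -/
def negInd (i : Idx) : ℂ := if i.1 < 0 then 1 else 0

/-- Normal ordering subtracts the vacuum expectation value of `ψ_p^* ψ_q`, which is `1` for `p = q <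
0` and `0` otherwise. -/
theorem rhat_add (p q : Idx) :
    rhat p q + (if p = q then negInd p else 0) • 1 = psiStar p * psi q := by
  have h := psi_mul_psiStar q p
  rw [rhat]
  split_ifs with h1 h2 h2
  · subst h2
    rw [if_pos rfl] at h
    rw [negInd, if_pos h1.1, one_smul, ← h]
    exact neg_add_cancel_left (psi p * psiStar p) (psiStar p * psi p)
  · rw [if_neg (Ne.symm h2)] at h
    rw [zero_smul, add_zero]
    exact neg_eq_of_add_eq_zero_right (a := psi q * psiStar p) (b := psiStar p * psi q) h
  · subst h2
    rw [negInd, if_neg (fun h => h1 ⟨h, h⟩), zero_smul, add_zero]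
  · rw [zero_smul, add_zero]

/-- The bilinears `b_p a_q` satisfy the `gl` relations exactly. A scalar shift does not change a
commutator, but it reappears when the right-hand side is rewritten in terms of `E`; this produces
the cocycle. The relation is written with sums only, so that it makes sense over a semiring;
subtraction comes from the scalar `-1`. -/
theorem commutator_of_car {R : Type} [Semiring R] [Algebra ℂ R] (a b : Idx → R)
    (E : Idx → Idx → R)
    (haa : ∀ i j, a i * a j + a j * a i = 0) (hbb : ∀ i j, b i * b j + b j * b i = 0)
    (hab : ∀ i j, a i * b j + b j * a i = if i = j then 1 else 0)
    (hE : ∀ p q, E p q + (if p = q then negInd p else 0) • 1 = b p * a q) (p q m n : Idx) :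
    E p q * E m n + (if p = n then E m q else 0) =
      E m n * E p q + (if q = m then E p n else 0) +
        (if q = m ∧ p = n then negInd p - negInd q else 0) • 1 := by
  let _ := Algebra.semiringToRing ℂ (A := R)
  have h1 : (if q = m then b p * a n else 0) = b p * (if q = m then 1 else 0) * a n := by
    split_ifs <;> simp
  have h2 : (if p = n then b m * a q else 0) = b m * (if n = p then 1 else 0) * a q := by
    simp only [eq_comm (a := p)]; split_ifs <;> simp
  have key : b p * a q * (b m * a n) - b m * a n * (b p * a q) =
      (if q = m then b p * a n else 0) - (if p = n then b m * a q else 0) := by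
    -- After the two mixed contractions only `b b a a` terms remain; they cancel by the relations
    -- among the `a` and among the `b`.
    rw [h1, h2, ← hab, ← hab]
    linear_combination (norm := noncomm_ring) -(b p * b m * haa n q) + hbb p m * a n * a q
  have comm : E p q * E m n - E m n * E p q =
      b p * a q * (b m * a n) - b m * a n * (b p * a q) := by
    simp only [← hE, add_mul, mul_add, smul_mul_assoc, mul_smul_comm, one_mul, mul_one]
    generalize (if p = q then negInd p else 0) = c, (if m = n then negInd m else 0) = d
    simp only [smul_add, smul_smul, mul_comm d c]
    abel
  rw [← comm, ← hE p n, ← hE m q] at key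
  rw [sub_eq_iff_eq_add] at key
  rw [key]
  by_cases hq : q = m <;> by_cases hp : p = n
  · subst hq hp
    simp only [and_self, if_true, sub_smul]
    abel
  · subst hq
    simp only [hp, if_true, if_false, and_false, zero_smul, add_zero]
    abel
  · subst hp
    simp only [hq, Ne.symm hq, if_true, if_false, false_and, zero_smul, add_zero]
    abel
  · simp only [hq, hp, if_false, and_false, zero_smul, add_zero]
    abel

theorem rhat_commutator (p q m n : Idx) :
    rhat p q * rhat m n + (if p = n then rhat m q else 0) =
      rhat m n * rhat p q + (if q = m then rhat p n else 0) +
        (if q = m ∧ p = n then negInd p - negInd q else 0) • 1 :=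
  commutator_of_car psi psiStar rhat psi_mul_psi psiStar_mul_psiStar psi_mul_psiStar rhat_add
    p q m n

/-! ### Clifford relations of the spinor generators. -/

/-- The indicator of the pairs of indices of opposite sign. -/
def opp (i j : Idx) : ℂ := if i.1 * j.1 < 0 then 1 else 0

theorem sqrt_two_mul_self : ((Real.sqrt 2 : ℝ) : ℂ) * ((Real.sqrt 2 : ℝ) : ℂ) = 2 := by
  rw [← Complex.ofReal_mul, Real.mul_self_sqrt (by norm_num)]; norm_num

/-- The factor `opp i j` extends the relation to all indices, including those for which the
generator is set to zero. The `2` is the square of the normalization `√2`. -/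
theorem gam_mul_gam (i j m n : Idx) :
    gam i j * gam m n + gam m n * gam i j = (if i = n ∧ j = m then 2 * opp i j else 0) • 1 := by
  have aux (c : ℂ) (A B : Module.End ℂ SPol) :
      c • A * c • B + c • B * c • A = (c * c) • (A * B + B * A) := by
    simp only [smul_mul_assoc, mul_smul_comm, smul_smul, smul_add]
  rcases i.pos_or_neg with hi | hi <;> rcases j.pos_or_neg with hj | hj <;>
  rcases m.pos_or_neg with hm | hm <;> rcases n.pos_or_neg with hn | hn <;>
    simp only [gam, hi, hj, hm, hn, and_self, and_true, and_false, dite_true,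
      dite_false, zero_mul, mul_zero, add_zero, aux, create_mul_create, annihilate_mul_annihilate,
      annihilate_mul_create, add_comm (create _ * annihilate _), sqrt_two_mul_self, smul_zero]
  all_goals by_cases h : i = n ∧ j = m
  all_goals first
    | (obtain ⟨rfl, rfl⟩ := h; first | (exfalso; omega) | simp [opp, mul_neg_iff, hi, hj])
    | simp only [h, if_false, zero_smul]
  all_goals rw [if_neg, smul_zero]
  all_goals simp only [EmbeddingLike.apply_eq_iff_eq, Prod.mk.injEq, Subtype.mk.injEq]
  all_goals exact fun h' => h ⟨Subtype.ext (by omega), Subtype.ext (by omega)⟩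

/-! ### Counting indices below the cut-off. -/

theorem mem_cut {N : ℕ} {i : Idx} : i ∈ cut N ↔ |i.1| ≤ N := by
  simp [cut, Finset.mem_subtype, abs_le]

theorem card_cut_filter (N : ℕ) (P : ℤ → Prop) [DecidablePred P] :
    ((cut N).filter fun i => P i.1).card =
      ((Finset.Icc (-(N : ℤ)) N).filter fun k => k ≠ 0 ∧ P k).card := by
  refine Finset.card_bij (fun i _ => i.1) (fun i hi => ?_) (fun i _ j _ h => Subtype.ext h)
    fun k hk => ?_
  · simp only [Finset.mem_filter, mem_cut, abs_le, Finset.mem_Icc] at hi ⊢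
    exact ⟨hi.1, i.2, hi.2⟩
  · simp only [Finset.mem_filter, Finset.mem_Icc] at hk
    exact ⟨⟨k, hk.2.1⟩, by simpa [mem_cut, abs_le] using ⟨hk.1, hk.2.2⟩, rfl⟩

theorem card_cut_pos (N : ℕ) : ((cut N).filter fun i => 0 < i.1).card = N := by
  rw [card_cut_filter N (0 < ·)]
  have : ((Finset.Icc (-(N : ℤ)) N).filter fun k => k ≠ 0 ∧ 0 < k) = Finset.Icc 1 (N : ℤ) := by
    ext; simp; omega
  rw [this]; simp

theorem card_cut_neg (N : ℕ) : ((cut N).filter fun i => i.1 < 0).card = N := by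
  rw [card_cut_filter N (· < 0)]
  have : ((Finset.Icc (-(N : ℤ)) N).filter fun k => k ≠ 0 ∧ k < 0) =
      Finset.Icc (-(N : ℤ)) (-1) := by
    ext; simp; omega
  rw [this]; simp

theorem card_cut_opp (N : ℕ) (i : Idx) :
    ((cut N).filter fun k => i.1 * k.1 < 0).card = N := by
  rcases i.pos_or_neg with hi | hi
  · simpa [mul_neg_iff, hi] using card_cut_neg N
  · simpa [mul_neg_iff, hi] using card_cut_pos N

theorem opp_comm (i j : Idx) : opp i j = opp j i := by
  rw [opp, opp, mul_comm]

theorem opp_eq_of_pos {p q k : Idx} (h : 0 < p.1 * q.1) : opp k q = opp p k := by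
  rcases p.pos_or_neg with hp | hp <;> rcases q.pos_or_neg with hq | hq <;>
    simp [opp, mul_neg_iff, mul_pos_iff, hp, hq] at h ⊢

theorem sum_opp (N : ℕ) (i : Idx) : ∑ k ∈ cut N, opp i k = N := by
  simp only [opp, Finset.sum_boole, card_cut_opp]

theorem sum_opp' (N : ℕ) (i : Idx) : ∑ k ∈ cut N, opp k i = N := by
  simp only [opp_comm _ i, sum_opp]

theorem sum_negInd (N : ℕ) : ∑ k ∈ cut N, negInd k = N := by
  simp only [negInd, Finset.sum_boole, card_cut_neg]

theorem sgn_eq (i : Idx) : sgn i = 1 - 2 * negInd i := by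
  rcases i.pos_or_neg with hi | hi
  · simp [sgn, negInd, Int.sign_eq_one_of_pos hi.1, hi]
  · simp [sgn, negInd, Int.sign_eq_neg_one_of_neg hi.1, hi]; norm_num

theorem card_cut (N : ℕ) : ((cut N).card : ℂ) = 2 * N := by
  rw [← Finset.card_filter_add_card_filter_not (s := cut N) (fun i => i.1 < 0), Nat.cast_add,
    card_cut_neg]
  simp only [Idx.neg_iff, not_not, card_cut_pos]
  ring

theorem sum_reverse {ι M : Type} [AddCommMonoid M] (s : Finset ι) (f : ι → ι → ι → M) :
    ∑ i ∈ s, ∑ j ∈ s, ∑ k ∈ s, f i j k = ∑ k ∈ s, ∑ j ∈ s, ∑ i ∈ s, f i j k := by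
  rw [Finset.sum_comm]
  simp only [Finset.sum_comm (s := s) (t := s) (f := fun i k => f i _ k)]
  rw [Finset.sum_comm]

theorem sum_rotate {ι M : Type} [AddCommMonoid M] (s : Finset ι) (f : ι → ι → ι → ι → M) :
    ∑ i ∈ s, ∑ j ∈ s, ∑ k ∈ s, ∑ l ∈ s, f i j k l =
      ∑ i ∈ s, ∑ j ∈ s, ∑ k ∈ s, ∑ l ∈ s, f k l j i := by
  simp only [← Finset.sum_product']
  refine Finset.sum_nbij' (fun x => (x.2.2.2, x.2.2.1, x.1, x.2.1))
    (fun x => (x.2.2.1, x.2.2.2, x.2.1, x.1)) ?_ ?_ ?_ ?_ ?_ <;> simp_all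

/-! ### The cut-off identities in an abstract current–Clifford algebra. -/

/-- Operators `E_{ij}` with the commutation relations of the basic representation, and commuting
with them the generators `G_{ij}` of a Clifford algebra. -/
structure CurrentClifford (R : Type) [Semiring R] [Algebra ℂ R] where
  E : Idx → Idx → R
  G : Idx → Idx → R
  E_mul_E (p q m n : Idx) : E p q * E m n + (if p = n then E m q else 0) =
      E m n * E p q + (if q = m then E p n else 0) +
        (if q = m ∧ p = n then negInd p - negInd q else 0) • (1 : R)
  G_mul_G (i j m n : Idx) :
    G i j * G m n + G m n * G i j = (if i = n ∧ j = m then 2 * opp i j else 0) • (1 : R)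
  G_eq_zero (i j : Idx) (h : ¬ i.1 * j.1 < 0) : G i j = 0
  E_mul_G (i j m n : Idx) : E i j * G m n = G m n * E i j

namespace CurrentClifford

variable {R : Type} [Ring R] [Algebra ℂ R] (A : CurrentClifford R) (N : ℕ)

/-- Twice the cut-off Dirac operator. -/
def D : R := ∑ i ∈ cut N, ∑ j ∈ cut N, A.E i j * A.G j i

/-- The sums `∑ₖ G_{ik} G_{kj}`. -/
def K (i j : Idx) : R := ∑ k ∈ cut N, A.G i k * A.G k j

theorem opp_smul_G (i j : Idx) : opp i j • A.G i j = A.G i j := by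
  by_cases h : i.1 * j.1 < 0
  · simp [opp, h]
  · simp [A.G_eq_zero i j h]

/-- The anticommutator with `G p q` selects the single summand of `D` carrying `G q p`, hence the
coefficient `E p q`. -/
theorem G_mul_D {p q : Idx} (hp : p ∈ cut N) (hq : q ∈ cut N) :
    A.G p q * A.D N = (2 * opp p q) • A.E p q - A.D N * A.G p q := by
  rw [eq_sub_iff_add_eq]
  have (m n : Idx) : A.G p q * (A.E m n * A.G n m) + A.E m n * A.G n m * A.G p q =
      if p = m then (if q = n then (2 * opp p q) • A.E m n else 0) else 0 := by
    have h := A.G_mul_G p q n m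
    rw [← mul_assoc, ← A.E_mul_G, mul_assoc, mul_assoc, ← mul_add, h, ← ite_and]
    split_ifs <;> simp
  simp only [D, Finset.mul_sum, Finset.sum_mul, ← Finset.sum_add_distrib, this]
  simp [hp, hq]

theorem E_mul_D {p q : Idx} (hp : p ∈ cut N) (hq : q ∈ cut N) :
    A.E p q * A.D N = A.D N * A.E p q + ∑ k ∈ cut N, A.E p k * A.G k q -
      ∑ k ∈ cut N, A.E k q * A.G p k + (negInd p - negInd q) • A.G p q := by
  have (m n : Idx) : A.E p q * (A.E m n * A.G n m) = A.E m n * A.G n m * A.E p q +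
      (if q = m then A.E p n * A.G n q else 0) - (if p = n then A.E m q * A.G p m else 0) +
      (if q = m then if p = n then (negInd p - negInd q) • A.G p q else 0 else 0) := by
    have h := eq_sub_of_add_eq (A.E_mul_E p q m n)
    rw [← mul_assoc, h, sub_mul, add_mul, add_mul, mul_assoc, mul_assoc, A.E_mul_G]
    by_cases hq : q = m <;> by_cases hp : p = n
    · subst hq hp; simp only [and_self, if_true, smul_mul_assoc, one_mul]; abel
    all_goals simp [hq, hp]
  simp only [D, Finset.mul_sum, Finset.sum_mul, this, Finset.sum_add_distrib,
    Finset.sum_sub_distrib]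
  congr 1
  · congr 1
    · congr 1
      rw [Finset.sum_comm]
      simp [hq]
    · simp [hp]
  · simp [hp, hq]

theorem E_mul_G_mul_D {i j : Idx} (hi : i ∈ cut N) (hj : j ∈ cut N) :
    A.E i j * A.G j i * A.D N = (2 : ℂ) • opp i j • (A.E i j * A.E j i) -
      (A.D N * (A.E i j * A.G j i) + ∑ k ∈ cut N, A.E i k * (A.G k j * A.G j i) -
      ∑ k ∈ cut N, A.E k j * (A.G i k * A.G j i) +
      (negInd i - negInd j) • (A.G i j * A.G j i)) := by
  rw [mul_assoc, A.G_mul_D N hj hi, mul_sub, ← mul_assoc, A.E_mul_D N hi hj, opp_comm j i,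
    mul_smul_comm, mul_smul]
  simp only [add_mul, sub_mul, smul_mul_assoc, Finset.sum_mul, mul_assoc]

theorem sum_E_mul_K : ∑ i ∈ cut N, ∑ j ∈ cut N, ∑ k ∈ cut N, A.E i k * (A.G k j * A.G j i) =
    ∑ i ∈ cut N, ∑ j ∈ cut N, A.E i j * A.K N j i := by
  refine Finset.sum_congr rfl fun i _ => ?_
  rw [Finset.sum_comm]
  simp only [K, Finset.mul_sum]

/-- Exchanging the two Clifford factors reproduces the mixed sum with a minus sign. The contraction
occurs for `k = j`, and the remaining free index takes `N` values of the sign opposite to `k`. -/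
theorem sum_E_mul_K' : ∑ i ∈ cut N, ∑ j ∈ cut N, ∑ k ∈ cut N, A.E k j * (A.G i k * A.G j i) =
    (2 * N : ℂ) • ∑ i ∈ cut N, A.E i i - ∑ i ∈ cut N, ∑ j ∈ cut N, A.E i j * A.K N j i := by
  have (i j k : Idx) : A.E k j * (A.G i k * A.G j i) =
      (if k = j then (2 * opp i k) • A.E k j else 0) - A.E k j * (A.G j i * A.G i k) := by
    rw [eq_sub_of_add_eq (A.G_mul_G i k j i), mul_sub, mul_smul_comm, mul_one, ite_smul,
      zero_smul]
    simp only [true_and]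
  simp only [this, Finset.sum_sub_distrib]
  congr 1
  · rw [Finset.sum_comm, Finset.smul_sum]
    refine Finset.sum_congr rfl fun j hj => ?_
    simp only [Finset.sum_ite_eq', hj, if_true]
    rw [← Finset.sum_smul, ← Finset.mul_sum, sum_opp']
  · simp only [K, Finset.mul_sum]
    exact sum_reverse _ fun i j k => A.E k j * (A.G j i * A.G i k)

theorem two_smul_D_mul_D : (2 : ℂ) • (A.D N * A.D N) =
    (2 : ℂ) • ∑ i ∈ cut N, ∑ j ∈ cut N, opp i j • (A.E i j * A.E j i) -
      (2 : ℂ) • ∑ i ∈ cut N, ∑ j ∈ cut N, A.E i j * A.K N j i +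
      (2 * N : ℂ) • ∑ i ∈ cut N, A.E i i -
      ∑ i ∈ cut N, ∑ j ∈ cut N, (negInd i - negInd j) • (A.G i j * A.G j i) := by
  have h1 : A.D N * A.D N = ∑ i ∈ cut N, ∑ j ∈ cut N, A.E i j * A.G j i * A.D N := by
    conv_lhs => enter [1]; rw [D]
    simp only [Finset.sum_mul]
  have h2 : A.D N * A.D N = ∑ i ∈ cut N, ∑ j ∈ cut N, A.D N * (A.E i j * A.G j i) := by
    conv_lhs => enter [2]; rw [D]
    simp only [Finset.mul_sum]
  rw [Finset.sum_congr rfl fun i hi => Finset.sum_congr rfl fun j hj =>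
    A.E_mul_G_mul_D N hi hj] at h1
  simp only [Finset.sum_sub_distrib, Finset.sum_add_distrib] at h1
  rw [sum_E_mul_K, sum_E_mul_K', ← h2] at h1
  simp only [← Finset.smul_sum (r := (2 : ℂ))] at h1
  rw [two_smul]
  -- Only one copy of `D * D` is expanded; the other cancels the `-D * D` inside it.
  nth_rw 1 [h1]
  rw [two_smul ℂ (∑ i ∈ cut N, ∑ j ∈ cut N, A.E i j * A.K N j i)]
  abel

/-- Symmetrizing under `i ↔ j` replaces each product by half a scalar anticommutator. -/
theorem sum_G_mul_G :
    ∑ i ∈ cut N, ∑ j ∈ cut N, A.G i j * A.G j i = (2 * N ^ 2 : ℂ) • (1 : R) := by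
  have h : ∑ i ∈ cut N, ∑ j ∈ cut N, (A.G i j * A.G j i + A.G j i * A.G i j) =
      (4 * N ^ 2 : ℂ) • (1 : R) := by
    simp only [A.G_mul_G, and_self, if_true, ← Finset.sum_smul, ← Finset.mul_sum, sum_opp,
      Finset.sum_const, nsmul_eq_mul, card_cut]
    congr 1; ring
  simp only [Finset.sum_add_distrib] at h
  rw [Finset.sum_comm (f := fun i j => A.G j i * A.G i j), ← two_smul ℂ] at h
  have := congrArg ((1 / 2 : ℂ) • ·) h
  simp only [smul_smul] at this
  norm_num at this
  rw [this]
  congr 1; ring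

theorem sum_K_diag : ∑ i ∈ cut N, A.K N i i = (2 * N ^ 2 : ℂ) • (1 : R) := A.sum_G_mul_G N

/-- Carrying `G i k` past three odd factors changes the sign, so the product plus its cyclic
rotation is the sum of three contractions. The middle one requires `k = j`, where `G k j` is zero.
-/
theorem G_mul_G_mul_G_mul_G (i j k l : Idx) :
    A.G i k * (A.G k j * (A.G j l * A.G l i)) + A.G k j * (A.G j l * (A.G l i * A.G i k)) =
      (if i = j then (2 * opp i k) • (A.G j l * A.G l i) else 0) +
        (if k = l then (2 * opp i k) • (A.G k j * A.G j l) else 0) := by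
  have h1 := A.G_mul_G i k k j
  have h2 := A.G_mul_G i k j l
  have h3 := A.G_mul_G i k l i
  have h4 : A.G k j * (if i = l ∧ k = j then 2 * opp i k else 0) • (1 : R) * A.G l i = 0 := by
    split_ifs with h
    · rw [A.G_eq_zero k j (by rw [h.2]; exact not_lt.2 (mul_self_nonneg _))]; simp
    · simp
  have e1 : (if i = j then (2 * opp i k) • (A.G j l * A.G l i) else 0) =
      (if i = j ∧ k = k then 2 * opp i k else 0) • (1 : R) * (A.G j l * A.G l i) := by
    split_ifs <;> simp_all
  have e2 : (if k = l then (2 * opp i k) • (A.G k j * A.G j l) else 0) =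
      A.G k j * A.G j l * (if i = i ∧ k = l then 2 * opp i k else 0) • (1 : R) := by
    split_ifs <;> simp_all
  rw [e1, e2, ← h1, ← h3, ← add_zero (_ + _ * _ * (_ : R)), ← neg_zero, ← h4, ← h2]
  noncomm_ring

/-- The summed fourfold product is invariant under relabelling its closed chain of indices. Hence
twice the sum consists of contractions only, and each of the two surviving families contributes `2N
· 2N²`. -/
theorem sum_K_mul_K :
    ∑ i ∈ cut N, ∑ j ∈ cut N, A.K N i j * A.K N j i = (4 * N ^ 3 : ℂ) • (1 : R) := by
  have h (i j : Idx) : A.K N i j * A.K N j i =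
      ∑ k ∈ cut N, ∑ l ∈ cut N, A.G i k * (A.G k j * (A.G j l * A.G l i)) := by
    simp only [K, Finset.sum_mul, Finset.mul_sum, mul_assoc]
    rw [Finset.sum_comm]
  have h' : ∑ i ∈ cut N, ∑ j ∈ cut N, A.K N i j * A.K N j i =
      ∑ i ∈ cut N, ∑ j ∈ cut N, ∑ k ∈ cut N, ∑ l ∈ cut N,
        A.G k j * (A.G j l * (A.G l i * A.G i k)) := by
    simp only [h]
    exact sum_rotate _ fun i j k l => A.G i k * (A.G k j * (A.G j l * A.G l i))
  have h1 : ∑ i ∈ cut N, ∑ j ∈ cut N, ∑ k ∈ cut N, ∑ l ∈ cut N,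
      (if i = j then (2 * opp i k) • (A.G j l * A.G l i) else 0) = (4 * N ^ 3 : ℂ) • (1 : R) := by
    have (i : Idx) (hi : i ∈ cut N) : ∑ j ∈ cut N, ∑ k ∈ cut N, ∑ l ∈ cut N,
        (if i = j then (2 * opp i k) • (A.G j l * A.G l i) else 0) =
          (2 * N : ℂ) • ∑ l ∈ cut N, A.G i l * A.G l i := by
      rw [Finset.sum_eq_single_of_mem i hi fun j _ hj => by simp [hj.symm]]
      simp only [if_true, ← Finset.smul_sum, ← Finset.sum_smul, ← Finset.mul_sum, sum_opp]
    rw [Finset.sum_congr rfl this, ← Finset.smul_sum, sum_G_mul_G, smul_smul]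
    congr 1; ring
  have h2 : ∑ i ∈ cut N, ∑ j ∈ cut N, ∑ k ∈ cut N, ∑ l ∈ cut N,
      (if k = l then (2 * opp i k) • (A.G k j * A.G j l) else 0) = (4 * N ^ 3 : ℂ) • (1 : R) := by
    have (i j k : Idx) (hk : k ∈ cut N) : ∑ l ∈ cut N,
        (if k = l then (2 * opp i k) • (A.G k j * A.G j l) else 0) =
          (2 * opp i k) • (A.G k j * A.G j k) := by
      simp [hk]
    rw [Finset.sum_congr rfl fun i _ => Finset.sum_congr rfl fun j _ =>
      Finset.sum_congr rfl fun k hk => this i j k hk, sum_reverse]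
    simp only [← Finset.sum_smul, ← Finset.mul_sum, sum_opp', ← Finset.smul_sum, sum_G_mul_G,
      smul_smul]
    congr 1; ring
  have key : (2 : ℂ) • ∑ i ∈ cut N, ∑ j ∈ cut N, A.K N i j * A.K N j i =
      (2 : ℂ) • (4 * N ^ 3 : ℂ) • (1 : R) := by
    rw [two_smul ℂ (Finset.sum _ _)]
    nth_rw 2 [h']
    simp only [h, ← Finset.sum_add_distrib, G_mul_G_mul_G_mul_G]
    simp only [Finset.sum_add_distrib, h1, h2, two_smul]
  exact smul_right_injective R (two_ne_zero (α := ℂ)) key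

/-- `D` is contracted with each factor of `G p k * G k q`, with opposite signs. Since `p` and `q`
have the same sign, the indicator left by one contraction is absorbed by the remaining generator. -/
theorem K_commutator_D {p q : Idx} (hpq : 0 < p.1 * q.1) (hp : p ∈ cut N) (hq : q ∈ cut N) :
    A.K N p q * A.D N = A.D N * A.K N p q + (2 : ℂ) • ∑ k ∈ cut N, A.E k q * A.G p k
      - (2 : ℂ) • ∑ k ∈ cut N, A.E p k * A.G k q := by
  have h (k : Idx) (hk : k ∈ cut N) : A.G p k * A.G k q * A.D N =
      A.D N * (A.G p k * A.G k q) + (2 : ℂ) • (A.E k q * A.G p k) -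
        (2 : ℂ) • (A.E p k * A.G k q) := by
    rw [mul_assoc, A.G_mul_D N hk hq, mul_sub, ← mul_assoc, A.G_mul_D N hp hk, sub_mul,
      mul_smul_comm, mul_smul, ← A.E_mul_G, smul_mul_assoc, mul_smul (2 : ℂ) (opp p k),
      sub_sub_eq_add_sub, mul_assoc]
    have h1 : opp k q • (A.E k q * A.G p k) = A.E k q * A.G p k := by
      rw [opp_eq_of_pos hpq, ← mul_smul_comm, opp_smul_G]
    have h2 : opp p k • (A.E p k * A.G k q) = A.E p k * A.G k q := by
      rw [← opp_eq_of_pos hpq, ← mul_smul_comm, opp_smul_G]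
    rw [h1, h2, add_comm]
  rw [K, Finset.sum_mul, Finset.sum_congr rfl h]
  simp only [Finset.sum_sub_distrib, Finset.sum_add_distrib, Finset.mul_sum, Finset.smul_sum]

/-- The normal ordered operators `½ ∑ₖ :G_{ik} G_{kj}:`. -/
def Kt (i j : Idx) : R :=
  (1 / 2 : ℂ) • A.K N i j - (if i = j then N * negInd i else 0 : ℂ) • (1 : R)

theorem K_eq_zero {i j : Idx} (h : i.1 * j.1 < 0) : A.K N i j = 0 := by
  refine Finset.sum_eq_zero fun k _ => ?_
  by_cases hk : i.1 * k.1 < 0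
  · rw [A.G_eq_zero k j, mul_zero]
    rcases i.pos_or_neg with hi | hi <;> simp_all [mul_neg_iff] <;> omega
  · rw [A.G_eq_zero i k hk, zero_mul]

theorem Kt_eq_zero {i j : Idx} (h : i.1 * j.1 < 0) : A.Kt N i j = 0 := by
  have : i ≠ j := by rintro rfl; exact absurd h (not_lt.2 (mul_self_nonneg _))
  simp [Kt, A.K_eq_zero N h, this]

/-- Half the trace of `K` is `N²`, and normal ordering subtracts `N` for each of the `N` negative
indices. -/
theorem sum_Kt_diag : ∑ i ∈ cut N, A.Kt N i i = 0 := by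
  simp only [Kt, if_true, Finset.sum_sub_distrib, ← Finset.smul_sum, sum_K_diag,
    ← Finset.sum_smul, ← Finset.mul_sum, sum_negInd, smul_smul]
  rw [sub_eq_zero]; congr 1; ring

theorem sum_sgn_smul_Kt : ∑ i ∈ cut N, sgn i • A.Kt N i i =
    (2 * N ^ 2 : ℂ) • (1 : R) - ∑ i ∈ cut N, negInd i • A.K N i i := by
  have h := A.sum_Kt_diag N
  have hn (i : Idx) : negInd i * negInd i = negInd i := by unfold negInd; split_ifs <;> simp
  have h' : ∑ i ∈ cut N, negInd i • A.Kt N i i =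
      (1 / 2 : ℂ) • ∑ i ∈ cut N, negInd i • A.K N i i - (N ^ 2 : ℂ) • (1 : R) := by
    simp only [Kt, if_true, smul_sub, Finset.sum_sub_distrib, smul_smul, mul_left_comm _ (N : ℂ),
      hn, ← Finset.sum_smul, ← Finset.mul_sum, sum_negInd, Finset.smul_sum, mul_comm (1 / 2 : ℂ)]
    congr 2; ring
  simp only [sgn_eq, sub_smul, one_smul, Finset.sum_sub_distrib, h, mul_smul, ← Finset.smul_sum,
    h', smul_sub, zero_sub, neg_sub]
  rw [smul_smul (2 : ℂ) (1 / 2)]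
  norm_num

/-- The central term contributes through `negInd i - negInd j`. Swapping `i` and `j` in its second
part gives back the first with a minus sign, plus a contraction, which is the source of the constant
`N²`. -/
theorem D_mul_D : A.D N * A.D N =
    ∑ i ∈ cut N, ∑ j ∈ cut N, opp i j • (A.E i j * A.E j i) -
      ∑ i ∈ cut N, ∑ j ∈ cut N, A.E i j * A.K N j i + (N : ℂ) • ∑ i ∈ cut N, A.E i i -
      ∑ i ∈ cut N, negInd i • A.K N i i + (N ^ 2 : ℂ) • (1 : R) := by
  have h1 : ∑ i ∈ cut N, ∑ j ∈ cut N, negInd i • (A.G i j * A.G j i) =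
      ∑ i ∈ cut N, negInd i • A.K N i i := by
    simp only [K, Finset.smul_sum]
  have h2 : ∑ i ∈ cut N, ∑ j ∈ cut N, negInd j • (A.G i j * A.G j i) =
      (2 * N ^ 2 : ℂ) • (1 : R) - ∑ i ∈ cut N, negInd i • A.K N i i := by
    rw [eq_sub_iff_add_eq, ← h1, Finset.sum_comm]
    simp only [← Finset.sum_add_distrib, ← smul_add, A.G_mul_G, and_self, if_true, smul_smul]
    simp only [← Finset.sum_smul, ← Finset.mul_sum, sum_opp', sum_negInd, ← Finset.sum_mul]
    congr 1; ring
  have h3 := A.two_smul_D_mul_D N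
  simp only [sub_smul, Finset.sum_sub_distrib, h1, h2, mul_smul] at h3
  refine smul_right_injective R (two_ne_zero (α := ℂ)) ?_
  beta_reduce
  rw [h3]
  simp only [smul_add, smul_sub, two_smul]
  abel

theorem sum_opp_add_sum_same (f : Idx → Idx → R) : ∑ i ∈ cut N, ∑ j ∈ cut N, f i j =
    ∑ i ∈ cut N, ∑ j ∈ cut N, opp i j • f i j +
      ∑ i ∈ cut N, ∑ j ∈ (cut N).filter (fun j => 0 < i.1 * j.1), f i j := by
  simp only [← Finset.sum_add_distrib, Finset.sum_filter]
  refine Finset.sum_congr rfl fun i _ => Finset.sum_congr rfl fun j _ => ?_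
  have hi := i.2
  have hj := j.2
  rcases lt_or_gt_of_ne (mul_ne_zero hi hj) with h | h
  · simp [opp, h, h.not_gt]
  · simp [opp, h, h.not_gt]

theorem sum_Kt_mul_Kt : ∑ i ∈ cut N, ∑ j ∈ cut N, A.Kt N i j * A.Kt N j i =
    (2 * N ^ 3 : ℂ) • (1 : R) - (N : ℂ) • ∑ i ∈ cut N, negInd i • A.K N i i := by
  have hn (i : Idx) : negInd i * negInd i = negInd i := by unfold negInd; split_ifs <;> simp
  have h (i j : Idx) : A.Kt N i j * A.Kt N j i = (1 / 4 : ℂ) • (A.K N i j * A.K N j i) -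
      (if i = j then (N : ℂ) • negInd i • A.K N i i else 0) +
      (if i = j then ((N : ℂ) ^ 2 * negInd i) • (1 : R) else 0) := by
    rcases eq_or_ne i j with rfl | hij
    · have : (N : ℂ) ^ 2 * negInd i = (N * negInd i) * (N * negInd i) := by
        linear_combination -(N : ℂ) ^ 2 * hn i
      simp only [if_true, this, Kt, mul_smul_comm, smul_mul_assoc, mul_sub, sub_mul, one_mul,
        mul_one, smul_sub, smul_smul]
      module
    · simp only [Kt, hij, hij.symm, if_false, zero_smul, sub_zero, add_zero, mul_smul_comm,
        smul_mul_assoc, smul_smul]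
      norm_num
  have h1 : ∑ i ∈ cut N, ∑ j ∈ cut N, (if i = j then (N : ℂ) • negInd i • A.K N i i else 0) =
      (N : ℂ) • ∑ i ∈ cut N, negInd i • A.K N i i := by
    rw [Finset.smul_sum]
    exact Finset.sum_congr rfl fun i hi => by simp [hi]
  have h2 : ∑ i ∈ cut N, ∑ j ∈ cut N, (if i = j then ((N : ℂ) ^ 2 * negInd i) • (1 : R) else 0) =
      ((N : ℂ) ^ 3) • (1 : R) := by
    rw [pow_succ (N : ℂ) 2, ← sum_negInd N, Finset.mul_sum, Finset.sum_smul]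
    exact Finset.sum_congr rfl fun i hi => by simp [hi, sum_negInd]
  simp only [h, Finset.sum_add_distrib, Finset.sum_sub_distrib,
    ← Finset.smul_sum (r := (1 / 4 : ℂ)), sum_K_mul_K, h1, h2]
  module

theorem E_mul_K (i j m n : Idx) : A.E i j * A.K N m n = A.K N m n * A.E i j := by
  simp only [K, Finset.mul_sum, Finset.sum_mul]
  refine Finset.sum_congr rfl fun k _ => ?_
  rw [← mul_assoc, A.E_mul_G, mul_assoc, A.E_mul_G, mul_assoc]

theorem E_mul_Kt (i j m n : Idx) : A.E i j * A.Kt N m n = A.Kt N m n * A.E i j := by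
  simp only [Kt, mul_sub, sub_mul, mul_smul_comm, smul_mul_assoc, A.E_mul_K, one_mul, mul_one]

theorem sum_E_mul_Kt : ∑ i ∈ cut N, ∑ j ∈ cut N, A.E i j * A.Kt N j i =
    (1 / 2 : ℂ) • ∑ i ∈ cut N, ∑ j ∈ cut N, A.E i j * A.K N j i -
      (N : ℂ) • ∑ i ∈ cut N, negInd i • A.E i i := by
  simp only [Kt, mul_sub, Finset.sum_sub_distrib, Finset.smul_sum, mul_smul_comm, mul_one]
  congr 1
  refine Finset.sum_congr rfl fun i hi => ?_
  rw [Finset.sum_eq_single_of_mem i hi fun j _ hj => by simp [hj], if_pos rfl, mul_smul]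

/-- The terms involving `Kt` may be summed over all pairs, since `Kt` vanishes for indices of
opposite sign. The two mixed terms agree after `i ↔ j`, which removes the factor `1 / 2` in front of
`E K`. -/
theorem diagonal_casimir : ∑ i ∈ cut N, ∑ j ∈ (cut N).filter (fun j => 0 < i.1 * j.1),
      (A.E i j + A.Kt N i j) * (A.E j i + A.Kt N j i) =
    ∑ i ∈ cut N, ∑ j ∈ (cut N).filter (fun j => 0 < i.1 * j.1), A.E i j * A.E j i +
      ∑ i ∈ cut N, ∑ j ∈ cut N, A.E i j * A.K N j i -
      (2 * N : ℂ) • ∑ i ∈ cut N, negInd i • A.E i i +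
      ((2 * N ^ 3 : ℂ) • (1 : R) - (N : ℂ) • ∑ i ∈ cut N, negInd i • A.K N i i) := by
  have h := sum_opp_add_sum_same N
    (fun i j => A.E i j * A.Kt N j i + A.E j i * A.Kt N i j + A.Kt N i j * A.Kt N j i)
  have h0 (i j : Idx) : opp i j •
      (A.E i j * A.Kt N j i + A.E j i * A.Kt N i j + A.Kt N i j * A.Kt N j i) = 0 := by
    by_cases hij : i.1 * j.1 < 0
    · simp [A.Kt_eq_zero N hij, A.Kt_eq_zero N (mul_comm i.1 j.1 ▸ hij)]
    · simp [opp, hij]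
  simp only [h0, Finset.sum_const_zero, zero_add, Finset.sum_add_distrib, sum_Kt_mul_Kt,
    Finset.sum_comm (f := fun i j => A.E j i * A.Kt N i j), sum_E_mul_Kt] at h
  simp only [add_mul, mul_add, Finset.sum_add_distrib, ← A.E_mul_Kt]
  linear_combination (norm := module) (-1 : ℂ) • h

/-- `D²` supplies the opposite-sign half of the full Casimir sum and the diagonal Casimir the
same-sign half. The mixed terms cancel, and the remaining linear terms combine into sign-weighted
traces. -/
theorem four_smul_dirac_sq :
    A.D N * A.D N + (N ^ 2 : ℂ) • (1 : R) +
      ∑ i ∈ cut N, ∑ j ∈ (cut N).filter (fun j => 0 < i.1 * j.1),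
        (A.E i j + A.Kt N i j) * (A.E j i + A.Kt N j i) =
    ∑ i ∈ cut N, ∑ j ∈ cut N, A.E i j * A.E j i + ∑ i ∈ cut N, sgn i • A.Kt N i i +
      (N : ℂ) • ∑ i ∈ cut N, sgn i • (A.E i i + A.Kt N i i) := by
  simp only [smul_add, Finset.sum_add_distrib]
  rw [diagonal_casimir, D_mul_D, sum_opp_add_sum_same N (fun i j => A.E i j * A.E j i),
    sum_sgn_smul_Kt]
  simp only [sgn_eq, sub_smul, one_smul, Finset.sum_sub_distrib, mul_smul, ← Finset.smul_sum]
  module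

/-- The commutators of `E` and of `½ K` with `D` are opposite, and the central term is absent
because `p` and `q` have the same sign. -/
theorem Kt_add_E_commutator_D {p q : Idx} (hpq : 0 < p.1 * q.1) (hp : p ∈ cut N) (hq : q ∈ cut N) :
    (A.E p q + A.Kt N p q) * A.D N = A.D N * (A.E p q + A.Kt N p q) := by
  have hn : negInd p = negInd q := by
    rcases p.pos_or_neg with hp | hp <;> rcases q.pos_or_neg with hq | hq <;>
    simp [negInd, mul_pos_iff, hp, hq] at hpq ⊢
  simp only [Kt, add_mul, mul_add, sub_mul, mul_sub, smul_mul_assoc, mul_smul_comm,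
    one_mul, mul_one]
  rw [A.K_commutator_D N hpq hp hq, A.E_mul_D N hp hq, hn]
  module

theorem sum_same_K_mul_K : ∑ i ∈ cut N, ∑ j ∈ (cut N).filter (fun j => 0 < i.1 * j.1),
    ((1 / 2 : ℂ) • A.K N i j) * ((1 / 2 : ℂ) • A.K N j i) = (N ^ 3 : ℂ) • (1 : R) := by
  have h := sum_opp_add_sum_same N fun i j => ((1 / 2 : ℂ) • A.K N i j) * ((1 / 2 : ℂ) • A.K N j i)
  have h0 (i j : Idx) : opp i j • (((1 / 2 : ℂ) • A.K N i j) * ((1 / 2 : ℂ) • A.K N j i)) = 0 := by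
    by_cases hij : i.1 * j.1 < 0
    · simp [A.K_eq_zero N hij]
    · simp [opp, hij]
  simp only [h0, Finset.sum_const_zero, zero_add] at h
  rw [← h]
  simp only [smul_mul_assoc, mul_smul_comm, ← Finset.smul_sum, sum_K_mul_K, smul_smul]
  congr 1; ring

end CurrentClifford

/-! ### Normal ordering of the cut-off Casimir operator. -/

/-- The `-2i` of the Casimir operator is a difference of index counts; the correction `sgn i` is due
to the missing index `0`. -/
theorem sum_lt_sub_sum_gt {N : ℕ} {i : Idx} (hi : i ∈ cut N) :
    (∑ j ∈ cut N, if i.1 < j.1 then (1 : ℂ) else 0) -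
        ∑ j ∈ cut N, (if j.1 < i.1 then (1 : ℂ) else 0) =
      sgn i - 2 * (i.1 : ℂ) := by
  rw [mem_cut, abs_le] at hi
  have h1 := card_cut_filter N (i.1 < ·)
  have h2 := card_cut_filter N (· < i.1)
  beta_reduce at h1 h2
  simp only [Finset.sum_boole]
  suffices h : (((cut N).filter fun j => i.1 < j.1).card : ℤ) -
      ((cut N).filter fun j => j.1 < i.1).card = i.1.sign - 2 * i.1 by
    rw [sgn]; exact_mod_cast h
  rw [h1, h2]
  rcases i.pos_or_neg with hs | hs
  · have e1 : ((Finset.Icc (-(N : ℤ)) N).filter fun k => k ≠ 0 ∧ i.1 < k) =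
        Finset.Icc (i.1 + 1) N := by
      ext; simp; omega
    have e2 : ((Finset.Icc (-(N : ℤ)) N).filter fun k => k ≠ 0 ∧ k < i.1) =
        (Finset.Icc (-(N : ℤ)) (i.1 - 1)).erase 0 := by
      ext; simp; omega
    rw [e1, e2, Finset.card_erase_of_mem (by simp; omega), Int.sign_eq_one_of_pos hs.1]
    simp only [Int.card_Icc]
    omega
  · have e1 : ((Finset.Icc (-(N : ℤ)) N).filter fun k => k ≠ 0 ∧ i.1 < k) =
        (Finset.Icc (i.1 + 1) N).erase 0 := by
      ext; simp; omega
    have e2 : ((Finset.Icc (-(N : ℤ)) N).filter fun k => k ≠ 0 ∧ k < i.1) =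
        Finset.Icc (-(N : ℤ)) (i.1 - 1) := by
      ext; simp; omega
    rw [e1, e2, Finset.card_erase_of_mem (by simp; omega), Int.sign_eq_neg_one_of_neg hs.1]
    simp only [Int.card_Icc]
    omega

theorem sum_trichotomy {M : Type} [AddCommMonoid M] (s : Finset Idx) (f : Idx → Idx → M) :
    ∑ i ∈ s, ∑ j ∈ s, f i j = ∑ i ∈ s, ∑ j ∈ s, (if j.1 < i.1 then f i j else 0) +
      ∑ i ∈ s, ∑ j ∈ s, (if i.1 < j.1 then f i j else 0) + ∑ i ∈ s, f i i := by
  simp only [← Finset.sum_add_distrib]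
  refine Finset.sum_congr rfl fun i hi => ?_
  have h (j : Idx) : f i j = (if j.1 < i.1 then f i j else 0) +
      (if i.1 < j.1 then f i j else 0) + (if i = j then f i j else 0) := by
    rcases lt_trichotomy i.1 j.1 with h | h | h
    · have hij : i ≠ j := by rintro rfl; exact h.ne rfl
      simp [h, h.not_gt, hij]
    · simp [Subtype.ext h]
    · have hij : i ≠ j := by rintro rfl; exact h.ne rfl
      simp [h, h.not_gt, hij]
  conv_lhs => enter [2, j]; rw [h j]
  rw [Finset.sum_add_distrib, Finset.sum_ite_eq, if_pos hi, Finset.sum_add_distrib]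

/-- Only the pairs `i < j` need reordering. Their commutators give diagonal operators, weighted by
index counts, and the central term. -/
theorem sum_casimir_of_commutator {R : Type} [Ring R] [Algebra ℂ R] (E : Idx → Idx → R)
    (hE : ∀ p q m n, E p q * E m n + (if p = n then E m q else 0) =
      E m n * E p q + (if q = m then E p n else 0) +
        (if q = m ∧ p = n then negInd p - negInd q else 0) • (1 : R)) (N : ℕ) :
    ∑ i ∈ cut N, ∑ j ∈ cut N, E i j * E j i =
      (2 : ℂ) • ∑ i ∈ cut N, ∑ j ∈ cut N, (if j.1 < i.1 then E i j * E j i else 0) +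
        ∑ i ∈ cut N, (E i i * E i i + (sgn i - 2 * (i.1 : ℂ)) • E i i) + (N ^ 2 : ℂ) • (1 : R) := by
  have h (i j : Idx) : (if i.1 < j.1 then E i j * E j i else 0) =
      (if i.1 < j.1 then E j i * E i j else 0) + (if i.1 < j.1 then (1 : ℂ) else 0) • E i i -
        -- For `i < j` the central coefficient is the indicator of `i < 0 < j`; for `j ≤ i` that
        -- indicator is zero. It can therefore be summed over all pairs, as a product of two counts
        -- equal to `N`.
        (if i.1 < j.1 then (1 : ℂ) else 0) • E j j + (negInd i * (1 - negInd j)) • (1 : R) := by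
    split_ifs with hij
    · have := hE i j j i
      simp only [and_self, if_true] at this
      have hn : negInd i * (1 - negInd j) = negInd i - negInd j := by
        unfold negInd
        split_ifs <;> first | omega | simp
      rw [hn, eq_sub_of_add_eq this]
      module
    · have hn : negInd i * (1 - negInd j) = 0 := by
        have := i.2
        have := j.2
        unfold negInd
        split_ifs <;> first | omega | simp
      simp [hn]
  have h1 : ∑ i ∈ cut N, ∑ j ∈ cut N, (if i.1 < j.1 then (1 : ℂ) else 0) • E i i -
      ∑ i ∈ cut N, ∑ j ∈ cut N, (if i.1 < j.1 then (1 : ℂ) else 0) • E j j =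
      ∑ i ∈ cut N, (sgn i - 2 * (i.1 : ℂ)) • E i i := by
    rw [Finset.sum_comm (f := fun i j : Idx => (if i.1 < j.1 then (1 : ℂ) else 0) • E j j),
      ← Finset.sum_sub_distrib]
    refine Finset.sum_congr rfl fun i hi => ?_
    rw [← Finset.sum_smul, ← Finset.sum_smul, ← sub_smul, sum_lt_sub_sum_gt hi]
  have h2 : ∑ i ∈ cut N, ∑ j ∈ cut N, (negInd i * (1 - negInd j)) • (1 : R) =
      (N ^ 2 : ℂ) • (1 : R) := by
    simp only [← Finset.sum_smul, ← Finset.mul_sum, Finset.sum_sub_distrib, sum_negInd,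
      Finset.sum_const, nsmul_eq_mul, card_cut, ← Finset.sum_mul]
    congr 1; ring
  rw [sum_trichotomy]
  simp only [h, Finset.sum_add_distrib, Finset.sum_sub_distrib, h2, ← h1]
  rw [Finset.sum_comm (f := fun i j : Idx => if i.1 < j.1 then E j i * E i j else 0)]
  module

theorem casimirDiag_apply (i : Idx) (v : FPol) :
    casimirDiag i v = (rhat i i * rhat i i + (sgn i - 2 * (i.1 : ℂ)) • rhat i i) v := by
  simp only [casimirDiag, Module.End.mul_apply, LinearMap.add_apply, LinearMap.sub_apply, map_add,
    map_sub, LinearMap.smul_apply, map_smul, Module.End.one_apply]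
  module

theorem casimirRenCut_apply (N : ℕ) (v : FPol) : casimirRenCut N v =
    (2 : ℂ) • ∑ x ∈ cut N ×ˢ cut N, casimirOffDiag x v + ∑ i ∈ cut N, casimirDiag i v := by
  have h := @sum_casimir_of_commutator _ (Algebra.semiringToRing ℂ) _ rhat rhat_commutator N
  have h' : casimirCut N v = ((2 : ℂ) • ∑ i ∈ cut N, ∑ j ∈ cut N,
      (if j.1 < i.1 then rhat i j * rhat j i else 0) +
        ∑ i ∈ cut N, (rhat i i * rhat i i + (sgn i - 2 * (i.1 : ℂ)) • rhat i i) +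
          (N ^ 2 : ℂ) • (1 : Module.End ℂ FPol)) v := congrArg (· v) h
  rw [casimirRenCut, LinearMap.sub_apply, h', LinearMap.add_apply, LinearMap.smul_apply,
    add_sub_cancel_right, LinearMap.add_apply, LinearMap.smul_apply]
  simp only [LinearMap.sum_apply, casimirDiag_apply, Finset.sum_product, casimirOffDiag]

/-! ### Realization of the abstract identities on the tensor product. -/

theorem gam_eq_zero (i j : Idx) (h : ¬ i.1 * j.1 < 0) : gam i j = 0 := by
  rcases i.pos_or_neg with hi | hi <;> rcases j.pos_or_neg with hj | hj <;>
    simp [gam, mul_neg_iff, hi, hj] at h ⊢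

theorem gamNormal_add (i k j : Idx) :
    gamNormal i k j + (if i = j ∧ i.1 < k.1 then 2 * opp i k else 0) • 1 = gam i k * gam k j := by
  rw [gamNormal]
  split_ifs with h
  · obtain ⟨rfl, h⟩ := h
    have := gam_mul_gam i k k i
    rw [if_pos ⟨rfl, rfl⟩] at this
    rw [← this, add_comm (gam i k * gam k i)]
    exact neg_add_cancel_left (gam k i * gam i k) (gam i k * gam k i)
  · rw [zero_smul, add_zero]

theorem KCut_eq (N : ℕ) (i j : Idx) :
    KCut N i j = (1 / 2 : ℂ) • ∑ k ∈ cut N, gam i k * gam k j := by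
  rw [KCut]
  congr 1
  refine Finset.sum_filter_of_ne fun k _ h => ?_
  by_contra h'
  exact h (by rw [gam_eq_zero i k h', zero_mul])

/-- Reordering takes place only for `i = j < 0 < k`; each of the `N` such `k` contributes half of
the contraction `2`. -/
theorem KtCut_add (N : ℕ) (i j : Idx) :
    KtCut N i j + (if i = j then N * negInd i else 0 : ℂ) • 1 = KCut N i j := by
  have h : (if i = j then N * negInd i else 0 : ℂ) = (1 / 2 : ℂ) *
      ∑ k ∈ (cut N).filter (fun k => i.1 * k.1 < 0),
        (if i = j ∧ i.1 < k.1 then 2 * opp i k else 0) := by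
    split_ifs with h
    · subst h
      rw [Finset.sum_filter]
      have : ∀ k : Idx, (if i.1 * k.1 < 0 then (if i = i ∧ i.1 < k.1 then 2 * opp i k else 0)
          else 0) = 2 * negInd i * opp i k := by
        intro k
        rcases i.pos_or_neg with hi | hi <;> rcases k.pos_or_neg with hk | hk <;>
          by_cases hik : i.1 < k.1 <;> simp [opp, negInd, mul_neg_iff, hi, hk, hik] <;> omega
      rw [Finset.sum_congr rfl fun k _ => this k, ← Finset.mul_sum, sum_opp]
      ring
    · simp [h]
  rw [h, mul_smul, Finset.sum_smul, KtCut, KCut, ← smul_add, ← Finset.sum_add_distrib]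
  simp only [gamNormal_add]

theorem tmap_eq (A : Module.End ℂ FPol) (B : Module.End ℂ SPol) :
    tmap A B = tmap A 1 * tmap 1 B := by
  ext; rfl

theorem tmap_eq' (A : Module.End ℂ FPol) (B : Module.End ℂ SPol) :
    tmap A B = tmap 1 B * tmap A 1 := by
  ext; rfl

/-- The algebra homomorphism `A ↦ A ⊗ 1`. -/
def leftHom : Module.End ℂ FPol →ₐ[ℂ] Module.End ℂ Pol := Module.End.rTensorAlgHom ℂ FPol SPol

/-- The algebra homomorphism `B ↦ 1 ⊗ B`. -/
def rightHom : Module.End ℂ SPol →ₐ[ℂ] Module.End ℂ Pol := Module.End.lTensorAlgHom ℂ SPol FPol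

theorem leftHom_apply (A : Module.End ℂ FPol) : leftHom A = tmap A 1 := rfl
theorem rightHom_apply (B : Module.End ℂ SPol) : rightHom B = tmap 1 B := rfl

/-- The operators `E_{ij} ⊗ 1` and `1 ⊗ γ_{ij}`. -/
def polOps : CurrentClifford (Module.End ℂ Pol) where
  E i j := leftHom (rhat i j)
  G i j := rightHom (gam i j)
  E_mul_E p q m n := by
    have h := congrArg leftHom (rhat_commutator p q m n)
    simpa only [map_add, map_mul, map_smul, map_one, apply_ite leftHom, map_zero] using h
  G_mul_G i j m n := by
    have h := congrArg rightHom (gam_mul_gam i j m n)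
    simpa only [map_add, map_mul, map_smul, map_one] using h
  G_eq_zero i j h := by rw [gam_eq_zero i j h, map_zero]
  E_mul_G i j m n := by rw [leftHom_apply, rightHom_apply, ← tmap_eq, ← tmap_eq']

section PolIdentities

/-- The ring structure on the operators of `𝓕^pol ⊗ 𝕊^pol`, over the semiring structure of
`Module.End`. -/
abbrev polRing : Ring (Module.End ℂ Pol) := Algebra.semiringToRing ℂ

attribute [local instance] polRing

theorem diracCut_eq (N : ℕ) : diracCut N = (1 / 2 : ℂ) • polOps.D N := by
  rw [diracCut, CurrentClifford.D]
  simp only [Finset.smul_sum]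
  refine Finset.sum_congr rfl fun i _ => Finset.sum_congr rfl fun j _ => ?_
  rw [diracTerm]
  split_ifs with h
  · rw [tmap_eq]; rfl
  · rw [polOps.G_eq_zero j i (by rwa [mul_comm]), mul_zero, smul_zero]

theorem tmap_KCut (N : ℕ) (i j : Idx) : tmap 1 (KCut N i j) = (1 / 2 : ℂ) • polOps.K N i j := by
  rw [← rightHom_apply, KCut_eq, map_smul, map_sum, CurrentClifford.K]
  simp only [map_mul]
  rfl

theorem tmap_KtCut (N : ℕ) (i j : Idx) : tmap 1 (KtCut N i j) = polOps.Kt N i j := by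
  rw [CurrentClifford.Kt, eq_sub_iff_add_eq, ← tmap_KCut, ← rightHom_apply, ← rightHom_apply,
    ← KtCut_add, map_add, map_smul, map_one]

theorem rhoCut_eq (N : ℕ) (i j : Idx) : rhoCut N i j = polOps.E i j + polOps.Kt N i j := by
  rw [rhoCut, tmap_KtCut]; rfl

theorem tmap_spinCasimirCut (N : ℕ) :
    tmap 1 (spinCasimirCut N) = ((N : ℂ) ^ 3) • (1 : Module.End ℂ Pol) := by
  rw [← rightHom_apply, spinCasimirCut, ← polOps.sum_same_K_mul_K N]
  simp only [map_sum, map_mul, rightHom_apply, tmap_KCut]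

theorem tmap_traceCut (N : ℕ) : tmap 1 (traceCut N) = 0 := by
  rw [← rightHom_apply, traceCut, map_smul, map_sum]
  simp only [rightHom_apply, tmap_KtCut]
  rw [polOps.sum_Kt_diag, smul_zero]

theorem tmap_numCut (N : ℕ) :
    tmap 1 (numCut N) = ∑ i ∈ cut N, sgn i • polOps.Kt N i i := by
  rw [← rightHom_apply, numCut, map_sum]
  simp only [map_smul, rightHom_apply, tmap_KtCut]

theorem tmap_casimirCut (N : ℕ) :
    tmap (casimirCut N) 1 = ∑ i ∈ cut N, ∑ j ∈ cut N, polOps.E i j * polOps.E j i := by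
  rw [← leftHom_apply, casimirCut]
  simp only [map_sum, map_mul]
  rfl

theorem diracCut_sq_add (N : ℕ) :
    (4 : ℂ) • (diracCut N * diracCut N) + (N ^ 2 : ℂ) • (1 : Module.End ℂ Pol) +
      diagCasimirCut N = tmap (casimirCut N) 1 + tmap 1 (numCut N) + diagTraceCut N := by
  have h := polOps.four_smul_dirac_sq N
  rw [tmap_numCut, tmap_casimirCut, diagCasimirCut, diagTraceCut, diracCut_eq]
  simp only [rhoCut_eq]
  rw [← h, smul_mul_assoc, mul_smul_comm, smul_smul, smul_smul]
  norm_num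

theorem rhoCut_mul_diracCut (N : ℕ) {p q : Idx} (hpq : 0 < p.1 * q.1) (hp : p ∈ cut N)
    (hq : q ∈ cut N) : rhoCut N p q * diracCut N = diracCut N * rhoCut N p q := by
  rw [rhoCut_eq, diracCut_eq, mul_smul_comm, smul_mul_assoc,
    polOps.Kt_add_E_commutator_D N hpq hp hq]

end PolIdentities

theorem casimirRenCut_add (N : ℕ) :
    casimirRenCut N + ((N : ℂ) ^ 2) • 1 = casimirCut N :=
  sub_add_cancel (casimirCut N) _

theorem tmap_casimirRenCut_add (N : ℕ) (φ : Pol) :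
    tmap (casimirRenCut N) 1 φ + ((N : ℂ) ^ 2) • φ = tmap (casimirCut N) 1 φ := by
  rw [← casimirRenCut_add, ← leftHom_apply (_ + _), map_add, map_smul, map_one]
  rfl

theorem eq_add_sub_sub_of_add_eq {V : Type} [AddCommGroup V] {a b c d e f : V}
    (h : a + b + c = d + b + e + f) : a = d + e - (c - f) := by
  rw [add_assoc] at h
  rw [eq_sub_of_add_eq h]
  abel

theorem four_smul_diracCut_sq (N : ℕ) (φ : Pol) :
    (4 : ℂ) • diracCut N (diracCut N φ) =
      tmap (casimirRenCut N) 1 φ + tmap 1 (numCut N) φ -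
        (diagCasimirCut N φ - diagTraceCut N φ) := by
  have h : (4 : ℂ) • diracCut N (diracCut N φ) + ((N : ℂ) ^ 2) • φ + diagCasimirCut N φ =
      tmap (casimirCut N) 1 φ + tmap 1 (numCut N) φ + diagTraceCut N φ :=
    congrArg (· φ) (diracCut_sq_add N)
  rw [← tmap_casimirRenCut_add] at h
  exact eq_add_sub_sub_of_add_eq (V := Pol) h

/-! ### Pointwise finite families and exhaustion by cut-offs. -/

section PointwiseFinite

variable {α V : Type} [AddCommMonoid V] [Module ℂ V] {T : α → Module.End ℂ V}

theorem opSum_eq_sum (h : PointwiseFinite T) {v : V} {s : Finset α}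
    (hs : ∀ a, T a v ≠ 0 → a ∈ s) : opSum T v = ∑ a ∈ s, T a v := by
  have : opSum T v = ∑ᶠ a, T a v := by rw [opSum, dif_pos h]; rfl
  rw [this]
  exact finsum_eq_sum_of_support_subset _ fun a ha => hs a ha

theorem finite_ne_zero_add {v w : V} (hv : {a | T a v ≠ 0}.Finite) (hw : {a | T a w ≠ 0}.Finite) :
    {a | T a (v + w) ≠ 0}.Finite := by
  refine (hv.union hw).subset fun a ha => ?_
  by_contra h
  simp only [Set.mem_union, Set.mem_ofPred_eq, not_or, not_not] at h
  exact ha (by rw [map_add, h.1, h.2, add_zero])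

theorem pointwiseFinite_fock {ι : Type} {T : α → Module.End ℂ (FockPol ι)}
    (h : ∀ S, {a | T a (Finsupp.single S 1) ≠ 0}.Finite) : PointwiseFinite T := by
  intro v
  induction v using Finsupp.induction_linear with
  | zero => simp
  | add v w hv hw => exact finite_ne_zero_add hv hw
  | single S c =>
    refine (h S).subset fun a ha h0 => ha ?_
    rw [← mul_one c, ← smul_eq_mul, ← Finsupp.smul_single, map_smul, h0, smul_zero]

theorem pointwiseFinite_pol {T : α → Module.End ℂ Pol}
    (h : ∀ S S', {a | T a (Finsupp.single S 1 ⊗ₜ Finsupp.single S' 1) ≠ 0}.Finite) :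
    PointwiseFinite T := by
  intro φ
  induction φ using TensorProduct.induction_on with
  | zero => simp
  | add v w hv hw => exact finite_ne_zero_add hv hw
  | tmul v w =>
    induction v using Finsupp.induction_linear with
    | zero => simp
    | add v v' hv hv' => rw [TensorProduct.add_tmul]; exact finite_ne_zero_add hv hv'
    | single S c =>
      induction w using Finsupp.induction_linear with
      | zero => simp
      | add w w' hw hw' => rw [TensorProduct.tmul_add]; exact finite_ne_zero_add hw hw'
      | single S' c' =>
        refine (h S S').subset fun a ha h0 => ha ?_
        rw [← mul_one c, ← mul_one c', ← smul_eq_mul, ← smul_eq_mul, ← Finsupp.smul_single,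
          ← Finsupp.smul_single, TensorProduct.smul_tmul_smul, map_smul, h0, smul_zero]

theorem eventually_subset_cut (s : Finset Idx) : ∀ᶠ N in atTop, s ⊆ cut N := by
  refine (s.eventually_all (p := fun i N => i ∈ cut N)).2 fun i _ => ?_
  filter_upwards [eventually_ge_atTop i.1.natAbs] with N hN
  rw [mem_cut, abs_le]
  omega

theorem eventually_opSum_eq {T : Idx → Module.End ℂ V} (h : PointwiseFinite T) (v : V) :
    ∀ᶠ N in atTop, opSum T v = ∑ i ∈ cut N, T i v := by
  filter_upwards [eventually_subset_cut (h v).toFinset] with N hN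
  exact opSum_eq_sum h fun i hi => hN (by simpa using hi)

theorem eventually_opSum_prod_eq {T : Idx × Idx → Module.End ℂ V} (h : PointwiseFinite T) (v : V) :
    ∀ᶠ N in atTop, opSum T v = ∑ x ∈ cut N ×ˢ cut N, T x v := by
  filter_upwards [eventually_subset_cut ((h v).toFinset.image Prod.fst),
    eventually_subset_cut ((h v).toFinset.image Prod.snd)] with N h1 h2
  refine opSum_eq_sum h fun x hx => Finset.mem_product.2 ⟨h1 ?_, h2 ?_⟩
  · exact Finset.mem_image_of_mem _ (by simpa using hx)
  · exact Finset.mem_image_of_mem _ (by simpa using hx)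

end PointwiseFinite

/-! ### Which terms act nontrivially on a basis vector. -/

section Support

theorem psi_single_eq_zero {k : Idx} {S : Finset Idx} (hk : 0 < k.1) (h : k ∉ S) :
    psi k (Finsupp.single S 1) = 0 := by
  rw [psi, if_pos hk, annihilate_single, if_neg h]

theorem psiStar_single_eq_zero {k : Idx} {S : Finset Idx} (hk : k.1 < 0) (h : k ∉ S) :
    psiStar k (Finsupp.single S 1) = 0 := by
  rw [psiStar, if_neg hk.not_gt, annihilate_single, if_neg h]

theorem rhat_single_eq_zero_of_pos {p q : Idx} {S : Finset Idx} (hq : 0 < q.1) (h : q ∉ S) :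
    rhat p q (Finsupp.single S 1) = 0 := by
  rw [rhat, if_neg fun h' => hq.not_gt h'.2, Module.End.mul_apply,
    psi_single_eq_zero hq h, map_zero]

theorem rhat_single_eq_zero_of_neg {p q : Idx} {S : Finset Idx} (hp : p.1 < 0) (h : p ∉ S) :
    rhat p q (Finsupp.single S 1) = 0 := by
  rw [rhat]
  split_ifs with hpq
  · rw [LinearMap.neg_apply, Module.End.mul_apply, psiStar_single_eq_zero hp h, map_zero, neg_zero]
  -- Here `ψ_p^*` is an annihilator standing on the left; as `p ≠ q`, it can be anticommuted to the
  -- vector without contraction.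
  · have hne : q ≠ p := by rintro rfl; exact hpq ⟨hp, hp⟩
    have h1 := congrArg (· (Finsupp.single S 1)) (psi_mul_psiStar q p)
    simp only [hne, if_false, LinearMap.add_apply, Module.End.mul_apply,
      psiStar_single_eq_zero hp h, map_zero, zero_add, LinearMap.zero_apply] at h1
    exact h1

/-- The factor acting first is `E_{ji}` with `j < i`. A nonzero result needs `i` occupied if `i > 0`
and `j` occupied if `j < 0`; together with `j < i` this bounds both indices in every sign case. -/
theorem pointwiseFinite_casimirOffDiag : PointwiseFinite casimirOffDiag := by
  refine pointwiseFinite_fock fun S => ?_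
  obtain ⟨M, hM⟩ := (eventually_subset_cut S).exists
  refine (cut M ×ˢ cut M).finite_toSet.subset ?_
  rintro ⟨i, j⟩ hx
  rw [Set.mem_ofPred_eq, casimirOffDiag] at hx
  split_ifs at hx with hij
  · rw [Module.End.mul_apply] at hx
    have hi : 0 < i.1 → i ∈ cut M := fun hi => hM <| by
      by_contra h
      exact hx (by rw [rhat_single_eq_zero_of_pos hi h, map_zero])
    have hj : j.1 < 0 → j ∈ cut M := fun hj => hM <| by
      by_contra h
      exact hx (by rw [rhat_single_eq_zero_of_neg hj h, map_zero])
    rw [Finset.mem_coe, Finset.mem_product]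
    simp only [mem_cut, abs_le] at hi hj ⊢
    have := i.2
    have := j.2
    dsimp only at hij
    omega
  · exact absurd rfl hx

theorem rhat_self_single_eq_zero {i : Idx} {S : Finset Idx} (h : i ∉ S) :
    rhat i i (Finsupp.single S 1) = 0 := by
  rcases i.pos_or_neg with hi | hi
  · exact rhat_single_eq_zero_of_pos hi.1 h
  · exact rhat_single_eq_zero_of_neg hi.1 h

theorem pointwiseFinite_casimirDiag : PointwiseFinite casimirDiag := by
  refine pointwiseFinite_fock fun S => S.finite_toSet.subset fun i hi => ?_
  by_contra h
  refine hi ?_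
  rw [casimirDiag_apply, LinearMap.add_apply, LinearMap.smul_apply, Module.End.mul_apply,
    rhat_self_single_eq_zero h, map_zero, smul_zero, add_zero]

/-- The indices that occur in the modes of `S`. -/
def modeIdx (S : Finset SMode) : Finset Idx := S.image SMode.fst ∪ S.image SMode.snd

theorem exists_mode_of_gam_single_ne_zero {i j : Idx} {S : Finset SMode} (hi : i.1 < 0)
    (h : gam i j (Finsupp.single S 1) ≠ 0) : ∃ x ∈ S, x.fst = j ∧ x.snd = i := by
  rcases j.pos_or_neg with hj | hj
  · rw [gam, dif_neg (fun h => hi.not_gt h.1), dif_pos ⟨hi, hj.1⟩, LinearMap.smul_apply,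
      annihilate_single] at h
    split_ifs at h with hS
    · exact ⟨_, hS, rfl, rfl⟩
    · simp at h
  · rw [gam_eq_zero i j (by simp [mul_neg_iff]; omega)] at h
    simp at h

theorem mem_modeIdx_of_gam_single_ne_zero {i j : Idx} {S : Finset SMode} (hi : i.1 < 0)
    (h : gam i j (Finsupp.single S 1) ≠ 0) : i ∈ modeIdx S ∧ j ∈ modeIdx S := by
  obtain ⟨x, hx, rfl, rfl⟩ := exists_mode_of_gam_single_ne_zero hi h
  exact ⟨Finset.mem_union_right _ (Finset.mem_image_of_mem _ hx),
    Finset.mem_union_left _ (Finset.mem_image_of_mem _ hx)⟩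

/-- For `i > 0 > j` the spinor factor annihilates an occupied mode; for `i < 0 < j` the current
removes an occupied particle–antiparticle pair. Either way both indices are confined to a finite
set. -/
theorem pointwiseFinite_diracTerm : PointwiseFinite diracTerm := by
  refine pointwiseFinite_pol fun S S' =>
    ((S ∪ modeIdx S') ×ˢ (S ∪ modeIdx S')).finite_toSet.subset ?_
  rintro ⟨i, j⟩ hx
  rw [Set.mem_ofPred_eq, diracTerm] at hx
  split_ifs at hx with hij
  · rw [LinearMap.smul_apply, tmap, TensorProduct.map_tmul] at hx
    rw [Finset.mem_coe, Finset.mem_product, Finset.mem_union, Finset.mem_union]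
    rcases mul_neg_iff.1 hij with ⟨hi, hj⟩ | ⟨hi, hj⟩
    · have := mem_modeIdx_of_gam_single_ne_zero (i := j) (j := i) (S := S') hj
        fun h => hx (by rw [h, TensorProduct.tmul_zero, smul_zero])
      exact ⟨Or.inr this.2, Or.inr this.1⟩
    · constructor <;> left <;> by_contra h <;> refine hx ?_
      · rw [rhat_single_eq_zero_of_neg hi h, TensorProduct.zero_tmul, smul_zero]
      · rw [rhat_single_eq_zero_of_pos hj h, TensorProduct.zero_tmul, smul_zero]
  · exact absurd rfl hx

theorem KtTerm_of_pos {i : Idx} (hi : 0 < i.1) (j k : Idx) :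
    KtTerm i j k = (1 / 2 : ℂ) • (gam i k * gam k j) := by
  rw [KtTerm]
  split_ifs with h
  · rw [gamNormal, if_neg]
    rintro ⟨_, h'⟩
    exact absurd (mul_pos hi (hi.trans h')) h.not_gt
  · rw [gam_eq_zero i k h, zero_mul, smul_zero]

/-- For `i = j` this order is the prescribed normal ordering; for `i ≠ j` the two factors
anticommute without contraction. Thus the annihilator acts first in both cases. -/
theorem KtTerm_of_neg {i : Idx} (hi : i.1 < 0) (j k : Idx) :
    KtTerm i j k = (-1 / 2 : ℂ) • (gam k j * gam i k) := by
  rw [KtTerm]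
  split_ifs with h
  · have hn : gamNormal i k j = (-1 : ℂ) • (gam k j * gam i k) := by
      rw [gamNormal]
      have hk := pos_of_mul_neg_right h hi.le
      split_ifs with h'
      · rw [h'.1]
        exact (neg_one_smul ℂ (gam k j * gam j k)).symm
      · have hij : i ≠ j := fun e => h' ⟨e, hi.trans hk⟩
        have := gam_mul_gam i k k j
        rw [if_neg fun e => hij e.1, zero_smul] at this
        exact (eq_neg_of_add_eq_zero_left this).trans (neg_one_smul ℂ (gam k j * gam i k)).symm
    rw [hn, smul_smul]
    norm_num
  · rw [gam_eq_zero i k h, mul_zero, smul_zero]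

theorem exists_mode_of_KtTerm_single_ne_zero {i j k : Idx} (hij : 0 < i.1 * j.1)
    {S : Finset SMode} (h : KtTerm i j k (Finsupp.single S 1) ≠ 0) :
    ∃ x ∈ S, (0 < i.1 ∧ x.fst = j ∧ x.snd = k) ∨ (i.1 < 0 ∧ x.fst = k ∧ x.snd = i) := by
  rcases i.pos_or_neg with hi | hi
  · have hj : 0 < j.1 := pos_of_mul_pos_right hij hi.1.le
    rw [KtTerm_of_pos hi.1, LinearMap.smul_apply, Module.End.mul_apply] at h
    have hg : gam k j (Finsupp.single S 1) ≠ 0 := fun h0 => h (by rw [h0, map_zero, smul_zero])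
    have hk : k.1 < 0 := by
      rw [Idx.neg_iff]
      intro hk
      exact hg (by rw [gam_eq_zero k j (mul_pos hk hj).not_gt, LinearMap.zero_apply])
    obtain ⟨x, hx, h1, h2⟩ := exists_mode_of_gam_single_ne_zero hk hg
    exact ⟨x, hx, Or.inl ⟨hi.1, h1, h2⟩⟩
  · rw [KtTerm_of_neg hi.1, LinearMap.smul_apply, Module.End.mul_apply] at h
    have hg : gam i k (Finsupp.single S 1) ≠ 0 := fun h0 => h (by rw [h0, map_zero, smul_zero])
    obtain ⟨x, hx, h1, h2⟩ := exists_mode_of_gam_single_ne_zero hi.1 hg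
    exact ⟨x, hx, Or.inr ⟨hi.1, h1, h2⟩⟩

theorem fst_mem_modeIdx {x : SMode} {S : Finset SMode} (hx : x ∈ S) : x.fst ∈ modeIdx S :=
  Finset.mem_union_left _ (Finset.mem_image_of_mem _ hx)

theorem snd_mem_modeIdx {x : SMode} {S : Finset SMode} (hx : x ∈ S) : x.snd ∈ modeIdx S :=
  Finset.mem_union_right _ (Finset.mem_image_of_mem _ hx)

theorem mem_modeIdx_of_KtTerm_single_ne_zero {i j k : Idx} (hij : 0 < i.1 * j.1)
    {S : Finset SMode} (h : KtTerm i j k (Finsupp.single S 1) ≠ 0) : k ∈ modeIdx S := by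
  obtain ⟨x, hx, ⟨_, _, rfl⟩ | ⟨_, rfl, _⟩⟩ := exists_mode_of_KtTerm_single_ne_zero hij h
  · exact snd_mem_modeIdx hx
  · exact fst_mem_modeIdx hx

theorem pointwiseFinite_KtTerm {i j : Idx} (hij : 0 < i.1 * j.1) : PointwiseFinite (KtTerm i j) :=
  pointwiseFinite_fock fun S => (modeIdx S).finite_toSet.subset fun _ hk =>
    mem_modeIdx_of_KtTerm_single_ne_zero hij hk

theorem Idx.mul_self_pos (i : Idx) : 0 < i.1 * i.1 := _root_.mul_self_pos.2 i.2

theorem pointwiseFinite_numTerm : PointwiseFinite numTerm := by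
  refine pointwiseFinite_fock fun S => (modeIdx S).finite_toSet.subset fun i hi => ?_
  by_contra h
  refine hi ?_
  rw [numTerm, LinearMap.smul_apply, Kt, opSum_eq_sum (s := ∅) (pointwiseFinite_KtTerm
    i.mul_self_pos), Finset.sum_empty, smul_zero]
  intro k hk
  obtain ⟨x, hx, ⟨_, rfl, _⟩ | ⟨_, _, rfl⟩⟩ :=
    exists_mode_of_KtTerm_single_ne_zero i.mul_self_pos hk
  · exact absurd (fst_mem_modeIdx hx) h
  · exact absurd (snd_mem_modeIdx hx) h

/-- Trades a sum over an intermediate index `k` for a sum over occupied modes: one component of the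
mode is `k`, the other is held at `c`. -/
theorem sum_eq_sum_ite_of_injective {α β V : Type} [DecidableEq β] [AddCommMonoid V] {S : Finset α}
    {s : Finset β} {a b : α → β} {c : β} {f : β → V}
    (hab : ∀ x y, a x = a y → b x = b y → x = y) (hs : ∀ x ∈ S, a x ∈ s)
    (hf : ∀ k, f k ≠ 0 → ∃ x ∈ S, a x = k ∧ b x = c) :
    ∑ k ∈ s, f k = ∑ x ∈ S, if b x = c then f (a x) else 0 := by
  rw [← Finset.sum_filter, ← Finset.sum_image (f := f) (g := a)]
  · symm
    refine Finset.sum_subset (fun k hk => ?_) fun k _ hk => ?_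
    · obtain ⟨x, hx, rfl⟩ := Finset.mem_image.1 hk
      exact hs x (Finset.mem_filter.1 hx).1
    · by_contra h
      obtain ⟨x, hx, rfl, hc⟩ := hf k h
      exact hk (Finset.mem_image_of_mem _ (Finset.mem_filter.2 ⟨hx, hc⟩))
  · intro x hx y hy hxy
    simp only [Finset.coe_filter, Set.mem_ofPred_eq] at hx hy
    exact hab x y hxy (hx.2.trans hy.2.symm)

theorem SMode.ext' {x y : SMode} (h1 : x.fst = y.fst) (h2 : x.snd = y.snd) : x = y := by
  obtain ⟨⟨m, hm⟩, ⟨l, hl⟩⟩ := x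
  obtain ⟨⟨m', hm'⟩, ⟨l', hl'⟩⟩ := y
  have h1' : m = m' := congrArg Subtype.val h1
  have h2' : l = l' := congrArg Subtype.val h2
  subst h1' h2'
  rfl

theorem SMode.fst_pos (x : SMode) : 0 < x.fst.1 := (ofLex x).1.2

theorem SMode.snd_neg (x : SMode) : x.snd.1 < 0 := (ofLex x).2.2

/-- Each nonzero term of `K̃_{ij}` removes one occupied mode and inserts its image. For `i > 0` this
changes the positive component of the mode, for `i < 0` the negative one; the signs of the indices
kill the other half of the bracket. -/
theorem Kt_eq_isotropy {i j : Idx} (hij : 0 < i.1 * j.1) : Kt i j = isotropy i j := by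
  refine fock_ext fun S => ?_
  rw [Kt, opSum_eq_sum (pointwiseFinite_KtTerm hij)
    fun k hk => mem_modeIdx_of_KtTerm_single_ne_zero hij hk, isotropy,
    Finsupp.linearCombination_single, one_smul]
  rcases i.pos_or_neg with hi | hi
  · rw [sum_eq_sum_ite_of_injective (S := S) (a := SMode.snd) (b := SMode.fst) (c := j)
      (fun x y h1 h2 => SMode.ext' h2 h1) (fun x hx => snd_mem_modeIdx hx)]
    · refine Finset.sum_congr rfl fun x _ => ?_
      have h2 : x.snd ≠ i := fun h => hi.2 (h ▸ x.snd_neg)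
      rw [gamBracket, if_neg h2, KtTerm_of_pos hi.1]
      by_cases h : x.fst = j
      · rw [if_pos h, if_pos h.symm, ← h]
        exact congrArg (fun A => (1 / 2 : ℂ) • (A * gam x.snd x.fst) (Finsupp.single S 1))
          (sub_zero (gam i x.snd)).symm
      · rw [if_neg h, if_neg (Ne.symm h)]
        exact (smul_eq_zero_of_right (1 / 2 : ℂ) (congrArg (fun A => (A * gam x.snd x.fst)
          (Finsupp.single S 1)) (sub_zero (0 : Module.End ℂ SPol)))).symm
    · intro k hk
      obtain ⟨x, hx, ⟨_, h1, h2⟩ | ⟨h, _⟩⟩ := exists_mode_of_KtTerm_single_ne_zero hij hk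
      · exact ⟨x, hx, h2, h1⟩
      · exact absurd h hi.2
  · rw [sum_eq_sum_ite_of_injective (S := S) (a := SMode.fst) (b := SMode.snd) (c := i)
      (fun x y h1 h2 => SMode.ext' h1 h2) (fun x hx => fst_mem_modeIdx hx)]
    · refine Finset.sum_congr rfl fun x _ => ?_
      have hj : ¬ 0 < j.1 := fun hj => absurd hij (mul_neg_of_neg_of_pos hi.1 hj).not_gt
      have h2 : j ≠ x.fst := fun h => hj (h ▸ x.fst_pos)
      rw [gamBracket, if_neg h2, KtTerm_of_neg hi.1]
      by_cases h : x.snd = i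
      · rw [if_pos h, if_pos h, ← h, neg_div, LinearMap.smul_apply, neg_smul, ← smul_neg]
        exact congrArg ((1 / 2 : ℂ) • ·) (congrArg (fun A => (A * gam x.snd x.fst)
          (Finsupp.single S 1)) (zero_sub (gam x.fst j))).symm
      · rw [if_neg h, if_neg h]
        exact (smul_eq_zero_of_right (1 / 2 : ℂ) (congrArg (fun A => (A * gam x.snd x.fst)
          (Finsupp.single S 1)) (sub_zero (0 : Module.End ℂ SPol)))).symm
    · intro k hk
      obtain ⟨x, hx, ⟨h, _⟩ | ⟨_, h⟩⟩ := exists_mode_of_KtTerm_single_ne_zero hij hk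
      · exact absurd h hi.2
      · exact ⟨x, hx, h⟩

end Support

/-! ### Stabilization of the cut-off operators on fixed vectors. -/

theorem KtCut_apply (N : ℕ) (i j : Idx) (v : SPol) :
    KtCut N i j v = ∑ k ∈ cut N, KtTerm i j k v := by
  simp only [KtCut, Finset.smul_sum, LinearMap.sum_apply, Finset.sum_filter, KtTerm]
  exact Finset.sum_congr rfl fun k _ => by split_ifs <;> simp

/-- The threshold depends only on the modes occurring in `v`, not on the indices of the current.
This uniformity yields invariance under all cut-off currents at once. -/
theorem eventually_KtCut_eq (v : SPol) :
    ∀ᶠ N in atTop, ∀ x : Idx × Idx, 0 < x.1.1 * x.2.1 → KtCut N x.1 x.2 v = isotropy x.1 x.2 v := by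
  induction v using Finsupp.induction_linear with
  | zero => simp
  | add v w hv hw =>
    filter_upwards [hv, hw] with N h1 h2 x hx
    rw [map_add, map_add, h1 x hx, h2 x hx]
  | single S c =>
    filter_upwards [eventually_subset_cut (modeIdx S)] with N hN x hx
    rw [← mul_one c, ← smul_eq_mul, ← Finsupp.smul_single, map_smul, map_smul, KtCut_apply,
      ← Kt_eq_isotropy hx, Kt, opSum_eq_sum (pointwiseFinite_KtTerm hx)
        fun k hk => hN (mem_modeIdx_of_KtTerm_single_ne_zero hx hk)]

theorem eventually_tmap_left {A : ℕ → Module.End ℂ FPol} {B : Module.End ℂ FPol}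
    (h : ∀ v, ∀ᶠ N in atTop, A N v = B v) (φ : Pol) :
    ∀ᶠ N in atTop, tmap (A N) 1 φ = tmap B 1 φ := by
  induction φ using TensorProduct.induction_on with
  | zero => simp
  | add φ ψ hφ hψ =>
    filter_upwards [hφ, hψ] with N h1 h2
    rw [map_add, map_add, h1, h2]
  | tmul v w =>
    filter_upwards [h v] with N hN
    rw [tmap, tmap, TensorProduct.map_tmul, TensorProduct.map_tmul, hN]

theorem eventually_tmap_right {α : Type} {P : α → Prop} {A : ℕ → α → Module.End ℂ SPol}
    {B : α → Module.End ℂ SPol} (h : ∀ v, ∀ᶠ N in atTop, ∀ a, P a → A N a v = B a v) (φ : Pol) :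
    ∀ᶠ N in atTop, ∀ a, P a → tmap 1 (A N a) φ = tmap 1 (B a) φ := by
  induction φ using TensorProduct.induction_on with
  | zero => simp
  | add φ ψ hφ hψ =>
    filter_upwards [hφ, hψ] with N h1 h2 a ha
    rw [map_add, map_add, h1 a ha, h2 a ha]
  | tmul v w =>
    filter_upwards [h w] with N hN a ha
    rw [tmap, tmap, TensorProduct.map_tmul, TensorProduct.map_tmul, hN a ha]

theorem eventually_rhoCut_eq (φ : Pol) :
    ∀ᶠ N in atTop, ∀ p q : Idx, 0 < p.1 * q.1 → rhoCut N p q φ = rho p q φ := by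
  filter_upwards [eventually_tmap_right eventually_KtCut_eq φ] with N h p q hpq
  rw [rhoCut, rho, LinearMap.add_apply, LinearMap.add_apply, h (p, q) hpq]

theorem eventually_diracCut_eq (φ : Pol) : ∀ᶠ N in atTop, diracCut N φ = dirac φ := by
  filter_upwards [eventually_opSum_prod_eq pointwiseFinite_diracTerm φ] with N h
  rw [dirac, h, diracCut, Finset.sum_product]
  simp only [LinearMap.sum_apply]

theorem eventually_diracCut_sq_eq (φ : Pol) :
    ∀ᶠ N in atTop, diracCut N (diracCut N φ) = dirac (dirac φ) := by
  -- The second application needs its own threshold, taken at the fixed vector `dirac φ`.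
  filter_upwards [eventually_diracCut_eq φ, eventually_diracCut_eq (dirac φ)] with N h1 h2
  rw [h1, h2]

theorem eventually_casimirRenCut_eq (φ : Pol) :
    ∀ᶠ N in atTop, tmap (casimirRenCut N) 1 φ = tmap casimir 1 φ := by
  refine eventually_tmap_left (fun v => ?_) φ
  filter_upwards [eventually_opSum_prod_eq pointwiseFinite_casimirOffDiag v,
    eventually_opSum_eq pointwiseFinite_casimirDiag v] with N h1 h2
  rw [casimirRenCut_apply, casimir, LinearMap.add_apply, LinearMap.smul_apply, h1, h2]

theorem eventually_numCut_eq (φ : Pol) :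
    ∀ᶠ N in atTop, tmap 1 (numCut N) φ = tmap 1 num φ := by
  have h := eventually_tmap_right (α := Unit) (P := fun _ => True) (A := fun N _ => numCut N)
    (B := fun _ => num) (fun v => ?_) φ
  · filter_upwards [h] with N hN using hN () trivial
  filter_upwards [eventually_KtCut_eq v, eventually_opSum_eq pointwiseFinite_numTerm v]
    with N h1 h2 _ _
  rw [numCut, num, h2, LinearMap.sum_apply]
  refine Finset.sum_congr rfl fun i _ => ?_
  rw [numTerm, LinearMap.smul_apply, LinearMap.smul_apply, h1 (i, i) i.mul_self_pos,
    Kt_eq_isotropy i.mul_self_pos]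

/-! ### The invariant sector and the square of the Dirac operator. -/

theorem mem_sector {φ : Pol} : φ ∈ sector ↔ ∀ p q : Idx, 0 < p.1 * q.1 → rho p q φ = 0 := by
  simp [sector, Submodule.mem_iInf]

theorem mem_sectorCut {N : ℕ} {φ : Pol} : φ ∈ sectorCut N ↔
    ∀ p q : Idx, p ∈ cut N → q ∈ cut N → 0 < p.1 * q.1 → rhoCut N p q φ = 0 := by
  simp [sectorCut, Submodule.mem_iInf]

theorem vacuum_mem_sector : vacuum ∈ sector := by
  refine mem_sector.2 fun p q hpq => ?_
  have h1 : rhat p q (vac Idx) = 0 := by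
    rcases q.pos_or_neg with hq | hq
    · exact rhat_single_eq_zero_of_pos hq.1 (Finset.notMem_empty q)
    · exact rhat_single_eq_zero_of_neg (neg_of_mul_pos_left hpq hq.1.le) (Finset.notMem_empty p)
  have h2 : isotropy p q (vac SMode) = 0 := by
    rw [isotropy, vac, Finsupp.linearCombination_single, Finset.sum_empty, smul_zero]
  rw [rho, vacuum, LinearMap.add_apply, tmap, tmap, TensorProduct.map_tmul, TensorProduct.map_tmul,
    h1, h2, TensorProduct.zero_tmul, TensorProduct.tmul_zero, add_zero]

/-- At finite cut-off the diagonal currents commute exactly with the Dirac operator. One `N` is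
chosen so large that the cut-offs are invisible on both `φ` and `dirac φ`. -/
theorem dirac_mem_sector {φ : Pol} (hφ : φ ∈ sector) : dirac φ ∈ sector := by
  refine mem_sector.2 fun p q hpq => ?_
  obtain ⟨N, h1, h2, h3, h4⟩ := ((eventually_subset_cut {p, q}).and
    ((eventually_diracCut_eq φ).and ((eventually_rhoCut_eq φ).and
      (eventually_rhoCut_eq (dirac φ))))).exists
  have h := congrArg (· φ) (rhoCut_mul_diracCut N hpq (h1 (by simp)) (h1 (by simp)))
  simp only [Module.End.mul_apply] at h
  rw [← h4 p q hpq, ← h2, h, h3 p q hpq, mem_sector.1 hφ p q hpq, map_zero]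

theorem eventually_mem_sectorCut {φ : Pol} (hφ : φ ∈ sector) : ∀ᶠ N in atTop, φ ∈ sectorCut N := by
  filter_upwards [eventually_rhoCut_eq φ] with N h
  exact mem_sectorCut.2 fun p q _ _ hpq => by rw [h p q hpq, mem_sector.1 hφ p q hpq]

theorem diagCasimirCut_of_mem_sectorCut {N : ℕ} {φ : Pol} (hφ : φ ∈ sectorCut N) :
    diagCasimirCut N φ = 0 := by
  rw [diagCasimirCut, LinearMap.sum_apply]
  refine Finset.sum_eq_zero fun i hi => ?_
  rw [LinearMap.sum_apply]
  refine Finset.sum_eq_zero fun j hj => ?_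
  rw [Finset.mem_filter] at hj
  rw [Module.End.mul_apply, mem_sectorCut.1 hφ j i hj.1 hi (by rw [mul_comm]; exact hj.2), map_zero]

theorem diagTraceCut_of_mem_sectorCut {N : ℕ} {φ : Pol} (hφ : φ ∈ sectorCut N) :
    diagTraceCut N φ = 0 := by
  rw [diagTraceCut, LinearMap.smul_apply, LinearMap.sum_apply, Finset.sum_eq_zero, smul_zero]
  intro i hi
  rw [LinearMap.smul_apply, mem_sectorCut.1 hφ i i hi hi i.mul_self_pos, smul_zero]

theorem sub_zero_sub_zero {V : Type} [AddCommGroup V] (a : V) : a - (0 - 0) = a := by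
  abel

theorem add_sub_add_sub_add_sub_zero {V : Type} [AddCommGroup V] (a b c d e : V) :
    (a + b - b) + (c - c) + d - 0 - e = a + d - e := by
  abel

theorem four_smul_diracCut_sq_of_mem_sectorCut {N : ℕ} {φ : Pol} (hφ : φ ∈ sectorCut N) :
    (4 : ℂ) • diracCut N (diracCut N φ) =
      tmap (casimirRenCut N) 1 φ + tmap 1 (numCut N) φ := by
  rw [four_smul_diracCut_sq, diagCasimirCut_of_mem_sectorCut hφ, diagTraceCut_of_mem_sectorCut hφ]
  exact sub_zero_sub_zero (V := Pol) _

theorem four_smul_dirac_sq {φ : Pol} (hφ : φ ∈ sector) :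
    (4 : ℂ) • dirac (dirac φ) = tmap casimir 1 φ + tmap 1 num φ := by
  obtain ⟨N, h1, h2, h3, h4⟩ := ((eventually_diracCut_sq_eq φ).and
    ((eventually_casimirRenCut_eq φ).and ((eventually_numCut_eq φ).and
      (eventually_mem_sectorCut hφ)))).exists
  rw [← h1, ← h2, ← h3, four_smul_diracCut_sq_of_mem_sectorCut h4]

theorem unbounded_congr {U : Submodule ℂ Pol} {T T' : Module.End ℂ Pol}
    (h : ∀ φ ∈ U, T φ = T' φ) : unbounded U T = unbounded U T' := by
  refine LinearPMap.ext rfl fun x hx _ => ?_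
  exact congrArg incl
    (h _ ((U.equivMapOfInjective incl incl_injective).symm ⟨x, hx⟩).2)

end GrRes

end

theorem mainTheorem2 :
    -- the infinite sums are finite on each fixed vector of the domain, and
    -- the operators `K̃_{ij}` realize the isotropy representation
    (∀ i j : GrRes.Idx, 0 < i.1 * j.1 →
      GrRes.PointwiseFinite (GrRes.KtTerm i j) ∧ GrRes.Kt i j = GrRes.isotropy i j) ∧
    GrRes.PointwiseFinite GrRes.numTerm ∧
    GrRes.PointwiseFinite GrRes.casimirOffDiag ∧
    GrRes.PointwiseFinite GrRes.casimirDiag ∧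
    GrRes.PointwiseFinite GrRes.diracTerm ∧
    -- the Dirac operator is an operator in the invariant sector, which contains the vacuum
    GrRes.vacuum ∈ GrRes.sector ∧
    (∀ φ ∈ GrRes.sector, GrRes.dirac φ ∈ GrRes.sector) ∧
    -- its square, as an unbounded operator in the invariant sector
    GrRes.unbounded GrRes.sector ((4 : ℂ) • (GrRes.dirac * GrRes.dirac)) =
      GrRes.unbounded GrRes.sector
        (GrRes.tmap GrRes.casimir 1 + GrRes.tmap 1 GrRes.num) ∧
    -- on each fixed vector and for large `N`, the cut-off operators agree with their limits,
    -- the diverging terms cancel, and the square of the cut-off Dirac operator is as follows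
    (∀ φ : GrRes.Pol, ∃ N₀ : ℕ, ∀ N : ℕ, N₀ ≤ N →
      GrRes.diracCut N φ = GrRes.dirac φ ∧
      GrRes.diracCut N (GrRes.diracCut N φ) = GrRes.dirac (GrRes.dirac φ) ∧
      GrRes.tmap (GrRes.casimirRenCut N) 1 φ = GrRes.tmap GrRes.casimir 1 φ ∧
      GrRes.tmap 1 (GrRes.numCut N) φ = GrRes.tmap 1 GrRes.num φ ∧
      GrRes.tmap 1 (GrRes.spinCasimirCut N) φ = ((N : ℂ) ^ 3) • φ ∧
      GrRes.tmap 1 (GrRes.traceCut N) φ = 0 ∧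
      (4 : ℂ) • GrRes.diracCut N (GrRes.diracCut N φ) =
        (GrRes.tmap (GrRes.casimirCut N) 1 φ - ((N : ℂ) ^ 2) • φ) +
          (GrRes.tmap 1 (GrRes.spinCasimirCut N) φ - ((N : ℂ) ^ 3) • φ) +
          GrRes.tmap 1 (GrRes.numCut N) φ - GrRes.tmap 1 (GrRes.traceCut N) φ -
          (GrRes.diagCasimirCut N φ - GrRes.diagTraceCut N φ)) ∧
    -- the square on the invariant sector, for large `N`
    (∀ φ ∈ GrRes.sector, ∃ N₀ : ℕ, ∀ N : ℕ, N₀ ≤ N →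
      φ ∈ GrRes.sectorCut N ∧
      GrRes.diagCasimirCut N φ = 0 ∧
      GrRes.diagTraceCut N φ = 0 ∧
      (4 : ℂ) • GrRes.dirac (GrRes.dirac φ) =
        (4 : ℂ) • GrRes.diracCut N (GrRes.diracCut N φ) ∧
      (4 : ℂ) • GrRes.diracCut N (GrRes.diracCut N φ) =
        GrRes.tmap (GrRes.casimirRenCut N) 1 φ + GrRes.tmap 1 (GrRes.numCut N) φ) := by
  open GrRes in
  refine ⟨fun i j hij => ⟨pointwiseFinite_KtTerm hij, Kt_eq_isotropy hij⟩, pointwiseFinite_numTerm,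
    pointwiseFinite_casimirOffDiag, pointwiseFinite_casimirDiag, pointwiseFinite_diracTerm,
    vacuum_mem_sector, fun φ hφ => dirac_mem_sector hφ, unbounded_congr fun φ hφ => ?_,
    fun φ => ?_, fun φ hφ => ?_⟩
  · exact GrRes.four_smul_dirac_sq hφ
  · refine Filter.eventually_atTop.1 ?_
    filter_upwards [GrRes.eventually_diracCut_eq φ, GrRes.eventually_diracCut_sq_eq φ,
      GrRes.eventually_casimirRenCut_eq φ, GrRes.eventually_numCut_eq φ] with N h1 h2 h3 h4
    have hC : GrRes.tmap 1 (GrRes.spinCasimirCut N) φ = ((N : ℂ) ^ 3) • φ :=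
      congrArg (· φ) (GrRes.tmap_spinCasimirCut N)
    have hT : GrRes.tmap 1 (GrRes.traceCut N) φ = 0 := congrArg (· φ) (GrRes.tmap_traceCut N)
    refine ⟨h1, h2, h3, h4, hC, hT, ?_⟩
    -- The spinor Casimir minus `N³` and the trace term are zero, so the claimed expansion is the
    -- renormalized identity with vanishing terms inserted.
    rw [hC, hT, ← GrRes.tmap_casimirRenCut_add, GrRes.four_smul_diracCut_sq]
    exact (GrRes.add_sub_add_sub_add_sub_zero (V := GrRes.Pol) _ _ _ _ _).symm
  · refine Filter.eventually_atTop.1 ?_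
    filter_upwards [GrRes.eventually_diracCut_sq_eq φ, GrRes.eventually_mem_sectorCut hφ]
      with N h1 h2
    exact ⟨h2, GrRes.diagCasimirCut_of_mem_sectorCut h2, GrRes.diagTraceCut_of_mem_sectorCut h2,
      by rw [h1], GrRes.four_smul_diracCut_sq_of_mem_sectorCut h2⟩
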